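/- Let $\alpha\in\,]0,1[$, let $\vec\Lambda\subset\mathbb C$ be a $\mathbb Z$-lattice (a discrete additive subgroup spanning $\mathbb C$ over $\mathbb R$), and let $\Lambda=z_0+\vec\Lambda$ with $z_0\in\mathbb C$ be a $\mathbb Z$-grid. Let $\operatorname{covol}$ denote the covolume of $\vec\Lambda$. For $z\in\mathbb C^*$, $\beta\in\mathbb R$ and $k\in\mathbb Z$, put $z^{[\beta,k]}=|z|^\beta e^{i\beta\omega_k}$, where $\omega_k$ is the argument of $z$ lying in $[2\pi k,2\pi(k+1)[$. Let $\phi:\mathbb N\to\,]0,+\infty[$ be a function with $\phi(N)\to+\infty$ and $\frac{\phi(N)}{N^{1-\alpha}}\to\lambda\in[0,+\infty]$ as $N\to\infty$, and put $\psi(N)=\big(\frac{N^{2-\alpha}}{\phi(N)}\big)^2$. Define the level-separated empirical pair correlation measures $$\mathcal R^{\mathrm{lvl}}_{N,N',N''}=\frac1{(N'+N'')\psi(N)}\sum_{k=-N'}^{N''-1}\ \sum_{\substack{n,m\in\Lambda,\ n\ne m\\ 0<|n|,|m|\le N}}\Delta_{\phi(N)(n^{[\alpha,k]}-m^{[\alpha,k]})},$$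 where $\Delta_z$ is the Dirac mass at $z$ (with the convention that the measure is $0$ when $N'=N''=0$). Define the density $$\rho_{\alpha,\vec\Lambda,\lambda}(z)=\begin{cases}0&\text{if }\lambda=+\infty,\\[1mm] \dfrac{\pi}{\alpha^2(2-\alpha)\operatorname{covol}^2}&\text{if }\lambda=0,\\[3mm] \dfrac{\alpha^{\frac2{1-\alpha}}}{(1-\alpha)\operatorname{covol}}\Big(\dfrac{|z|}{\lambda}\Big)^{-\frac{4-2\alpha}{1-\alpha}}\displaystyle\sum_{p\in\vec\Lambda,\ |p|\le\frac{|z|}{\alpha\lambda}}|p|^{\frac2{1-\alpha}}&\text{if }\lambda\in\,]0,+\infty[.\end{cases}$$ For a compactly supported $C^1$ function $f:\mathbb C\to\mathbb C$ (of two real variables), put $\|f\|_\infty=\sup_z|f(z)|$ and $\|df\|_\infty=\sup_z\|df(z)\|$ (operator norm of $\mathbb R$-linear maps $\mathbb C\to\mathbb C$). Let $D(0,A)$ denote the open disk of radius $A$ about $0$. (1) Suppose $\lambda=+\infty$ and $A>1$. Then there is an integer $N_0$, depending only on $\alpha,\Lambda,\phi,A$, such that for all $N\ge N_0$, all $N',N''\in\mathbb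 N$ and all compactly supported $C^1$ functions $f$ with $\operatorname{supp}f\subset D(0,A)$, we have $\mathcal R^{\mathrm{lvl}}_{N,N',N''}(f)=0$. (2) There is a constant $c>0$ depending only on $\alpha$ and $\Lambda$ such that the following holds for every $\phi$ as above with limit $\lambda\in[0,+\infty[$ and every $A>1$. There is an integer $N_0$, depending only on $\alpha,\Lambda,\phi,A$, such that for all $N\ge N_0$, all $N',N''\in\mathbb N$ with $N'+N''\ge1$ and all compactly supported $C^1$ functions $f$ with $\operatorname{supp}f\subset D(0,A)$, $$\Big|\mathcal R^{\mathrm{lvl}}_{N,N',N''}(f)-\int_{\mathbb C}f(z)\,\rho_{\alpha,\vec\Lambda,\lambda}(z)\,dz\Big|\le c\,E,$$ where, if $\lambda=0$, $$E=A^4\big(\|f\|_\infty+\|df\|_\infty\big)\Big(\frac{\phi(N)}{N^{1-\alpha}}+\frac1{N^\alpha\phi(N)}+\frac1{N'+N''}\Big),$$ and, if $\lambda\in\,]0,+\infty[$, $$E=\big(\|f\|_\infty+\|df\|_\infty\big)\Big(\lambda+\frac1\lambda\Big)^{\frac{10-8\alpha}{1-\alpha}}\Big(A^{\frac{8-6\alpha}{1-\alpha}}\Big|\frac{\phi(N)}{\lambda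 N^{1-\alpha}}-1\Big|+\frac{A^4}{N}+\frac{A^2}{N'+N''}\Big).$$ -/

import Mathlib

open MeasureTheory Filter Topology
open scoped ENNReal

noncomputable section

namespace GridCorrelation

/-- The level-`k` power `z^{[β,k]} = |z|^β e^{iβω_k}`, where `ω_k` is the representative of
`arg z` in `[2πk, 2π(k+1)[`. It is only used at nonzero `z`. -/
def levelPow (β : ℝ) (k : ℤ) (z : ℂ) : ℂ :=
  ((‖z‖ ^ β : ℝ) : ℂ) *
    Complex.exp (Complex.I * (β : ℂ) *
      ((toIcoMod Real.two_pi_pos (2 * Real.pi * (k : ℝ)) z.arg : ℝ) : ℂ))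

/-- The grid `z₀ + L`, where `L` is its underlying lattice. -/
def grid (L : Submodule ℤ ℂ) (z₀ : ℂ) : Set ℂ := (fun p => z₀ + p) '' (L : Set ℂ)

theorem finite_lattice_le (L : Submodule ℤ ℂ) [DiscreteTopology L] (r : ℝ) :
    {p : ℂ | p ∈ L ∧ ‖p‖ ≤ r}.Finite := by
  have : DiscreteTopology L.toAddSubgroup := (inferInstance : DiscreteTopology L)
  have hclosed : IsClosed (L : Set ℂ) :=
    AddSubgroup.isClosed_of_discrete (H := L.toAddSubgroup)
  have h := Metric.finite_isBounded_inter_isClosed (s := (L : Set ℂ))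
    ‹DiscreteTopology L›.isDiscrete
    (Metric.isBounded_closedBall (x := (0 : ℂ)) (r := r)) hclosed
  refine h.subset ?_
  rintro p ⟨hp, hr⟩
  exact ⟨by simpa using hr, hp⟩

theorem finite_grid_le (L : Submodule ℤ ℂ) [DiscreteTopology L] (z₀ : ℂ) (r : ℝ) :
    {z : ℂ | z ∈ grid L z₀ ∧ 0 < ‖z‖ ∧ ‖z‖ ≤ r}.Finite := by
  refine ((finite_lattice_le L (r + ‖z₀‖)).image (fun p => z₀ + p)).subset ?_
  rintro z ⟨⟨p, hp, rfl⟩, -, hr⟩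
  refine ⟨p, ⟨hp, ?_⟩, rfl⟩
  have h : ‖(z₀ + p) - z₀‖ ≤ ‖z₀ + p‖ + ‖z₀‖ := norm_sub_le _ _
  simp only [add_sub_cancel_left] at h
  simp only at hr
  linarith

/-- The lattice points of modulus at most `r`. -/
def latticePts (L : Submodule ℤ ℂ) [DiscreteTopology L] (r : ℝ) : Finset ℂ :=
  (finite_lattice_le L r).toFinset

/-- The nonzero grid points of modulus at most `r`. -/
def gridPts (L : Submodule ℤ ℂ) [DiscreteTopology L] (z₀ : ℂ) (r : ℝ) : Finset ℂ :=
  (finite_grid_le L z₀ r).toFinset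

/-- The renormalization factor `ψ(N) = (N^{2-α} / φ(N))²` attached to the scaling factor `φ`. -/
def renorm (α : ℝ) (φ : ℕ → ℝ) (N : ℕ) : ℝ := ((N : ℝ) ^ (2 - α) / φ N) ^ 2

/-- The level-separated empirical pair correlation measure of the grid `z₀ + L`: the sum, over
the levels `-N' ≤ k ≤ N'' - 1` and the ordered pairs `(n, m)` of distinct nonzero grid points of
modulus at most `N`, of the Dirac masses at `φ(N) (n^{[α,k]} - m^{[α,k]})`, divided by
`(N' + N'') ψ(N)`. -/
def lvlMeasure (α : ℝ) (L : Submodule ℤ ℂ) [DiscreteTopology L] (z₀ : ℂ) (φ : ℕ → ℝ)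
    (N N' N'' : ℕ) : Measure ℂ :=
  ENNReal.ofReal (1 / (((N' : ℝ) + (N'' : ℝ)) * renorm α φ N)) •
    ∑ k ∈ Finset.Ico (-(N' : ℤ)) (N'' : ℤ),
      ∑ q ∈ (gridPts L z₀ N ×ˢ gridPts L z₀ N).filter (fun q => q.1 ≠ q.2),
        Measure.dirac ((φ N : ℂ) * (levelPow α k q.1 - levelPow α k q.2))

/-- The limit density `ρ_{α,L,lam}`, for `lam ∈ [0,+∞]`. -/
def rho (α : ℝ) (L : Submodule ℤ ℂ) [DiscreteTopology L] (lam : ℝ≥0∞) (z : ℂ) : ℝ :=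
  if lam = ⊤ then 0
  else if lam = 0 then Real.pi / (α ^ 2 * (2 - α) * ZLattice.covolume L ^ 2)
  else
    α ^ (2 / (1 - α)) / ((1 - α) * ZLattice.covolume L)
      * (‖z‖ / lam.toReal) ^ (-((4 - 2 * α) / (1 - α)))
      * ∑ p ∈ latticePts L (‖z‖ / (α * lam.toReal)), ‖p‖ ^ (2 / (1 - α))

/-- `‖f‖_∞` -/
def supNorm (f : ℂ → ℂ) : ℝ := ⨆ z : ℂ, ‖f z‖

/-- `‖df‖_∞`, with the operator norm of `ℝ`-linear maps from `ℂ` to `ℂ`. -/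
def supNormDeriv (f : ℂ → ℂ) : ℝ := ⨆ z : ℂ, ‖fderiv ℝ f z‖

/-- The quantity inside the Landau symbol of the error term, for finite `lam`. -/
def errTerm (α : ℝ) (φ : ℕ → ℝ) (lam : ℝ≥0∞) (f : ℂ → ℂ) (A : ℝ) (N N' N'' : ℕ) : ℝ :=
  if lam = 0 then
    A ^ 4 * (supNorm f + supNormDeriv f) *
      (φ N / (N : ℝ) ^ (1 - α) + 1 / ((N : ℝ) ^ α * φ N) + 1 / ((N' : ℝ) + (N'' : ℝ)))
  else
    (supNorm f + supNormDeriv f)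
      * (lam.toReal + 1 / lam.toReal) ^ ((10 - 8 * α) / (1 - α))
      * (A ^ ((8 - 6 * α) / (1 - α)) * |φ N / (lam.toReal * (N : ℝ) ^ (1 - α)) - 1|
          + A ^ 4 / (N : ℝ) + A ^ 2 / ((N' : ℝ) + (N'' : ℝ)))

/-- `φ` is a scaling factor with limit ratio `lam ∈ [0,+∞]`: it is positive, tends to `+∞`, and
`φ(N) / N^{1-α}` tends to `lam`. -/
structure IsScaling (α : ℝ) (φ : ℕ → ℝ) (lam : ℝ≥0∞) : Prop where
  pos : ∀ N, 0 < φ N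
  tendsto_atTop : Tendsto φ atTop atTop
  tendsto_ratio :
    Tendsto (fun N : ℕ => ENNReal.ofReal (φ N / (N : ℝ) ^ (1 - α))) atTop (𝓝 lam)

end GridCorrelation

end

namespace GridCorrelation

/-! The angles of two points at the same level differ by less than 2π, and α < 1, so level powers
satisfy |n^{[α,k]} - m^{[α,k]}| ≥ c |n - m| max(|n|, |m|)^{α-1} (`exists_levelPow_separation`). A
pair therefore contributes only if p = n - m has modulus at most R = A N^{1-α} / (cφ). If λ = +∞,
then R eventually falls below the length of the shortest lattice vector and nothing contributes.

Otherwise pairs are indexed by p and m. Away from the real axis, where the argument may jump, and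
from the circle |m| = N, the difference (m+p)^{[α,k]} - m^{[α,k]} is close to α m^{[α-1,k]} p. The
sum over m is then covol⁻¹ times the integral over the disk |w| ≤ N of f(φ α w^{[α-1,k]} p). Summed
over the O(R²) vectors p, the error is O(N^{4-3α}/φ³) = O(ψ / (N^α φ)) (`exists_pair_comparison`).

If λ = 0, the sum over p is a Riemann sum of mesh |u|, with u = φ α w^{[α-1,k]}. It is about covol⁻¹
|u|⁻² ∫ f, and integrating |u|⁻² over the disk gives the constant density, for each level separately
(`exists_integral_comparison_of_zero`).

If 0 < λ < ∞, boundedly many p remain. In polar coordinates level k makes the angle (α-1)ω run over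
ω in [2πk, 2π(k+1)[. Consecutive levels concatenate, so their average is a full circle average up to
O(1/(N'+N'')) (`norm_level_sum_sub_le`). Replacing φ/N^{1-α} by λ costs a multiple of the relative
error, and the substitution s = αλ|p| r^{α-1} turns the radial integrals into the density
(`IsTest.integral_mul_rho`). -/

/-! ### Test functions. -/

/-- A continuous function bounded by `M`, `M`-Lipschitz, and vanishing outside the disk of
radius `A`. -/
structure IsTest (f : ℂ → ℂ) (A M : ℝ) : Prop where
  cont : Continuous f
  bound : ∀ z, ‖f z‖ ≤ M
  lip : ∀ x y, ‖f x - f y‖ ≤ M * ‖x - y‖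
  zero : ∀ z, A ≤ ‖z‖ → f z = 0

theorem IsTest.nonneg {f : ℂ → ℂ} {A M : ℝ} (h : IsTest f A M) : 0 ≤ M :=
  (norm_nonneg _).trans (h.bound 0)

theorem supNorm_nonneg (f : ℂ → ℂ) : 0 ≤ supNorm f := Real.iSup_nonneg fun _ => norm_nonneg _

theorem supNormDeriv_nonneg (f : ℂ → ℂ) : 0 ≤ supNormDeriv f :=
  Real.iSup_nonneg fun _ => norm_nonneg _

theorem isTest_of_contDiff {f : ℂ → ℂ} {A : ℝ} (hf : ContDiff ℝ 1 f) (hc : HasCompactSupport f)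
    (hs : tsupport f ⊆ Metric.ball 0 A) : IsTest f A (supNorm f + supNormDeriv f) := by
  have h1 : ∀ z, ‖f z‖ ≤ supNorm f := by
    obtain ⟨C, hC⟩ := hc.exists_bound_of_continuous hf.continuous
    exact le_ciSup (f := fun z => ‖f z‖) ⟨C, by rintro _ ⟨z, rfl⟩; exact hC z⟩
  have h2 : ∀ z, ‖fderiv ℝ f z‖ ≤ supNormDeriv f := by
    obtain ⟨C, hC⟩ := (hc.fderiv ℝ).exists_bound_of_continuous (hf.continuous_fderiv one_ne_zero)
    exact le_ciSup (f := fun z => ‖fderiv ℝ f z‖) ⟨C, by rintro _ ⟨z, rfl⟩; exact hC z⟩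
  refine ⟨hf.continuous, fun z => (h1 z).trans (by linarith [supNormDeriv_nonneg f]), ?_, ?_⟩
  · intro x y
    refine ((convex_univ (𝕜 := ℝ) (E := ℂ)).norm_image_sub_le_of_norm_fderiv_le (𝕜 := ℝ)
      (fun z _ => (hf.differentiable one_ne_zero) z) (fun z _ => h2 z) (Set.mem_univ y)
      (Set.mem_univ x)).trans ?_
    gcongr
    linarith [supNorm_nonneg f]
  · intro z hz
    refine image_eq_zero_of_notMem_tsupport fun h => ?_
    have := hs h
    simp at this
    linarith

/-! ### Lattice and grid points; comparing sums with integrals. -/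

theorem mem_latticePts (L : Submodule ℤ ℂ) [DiscreteTopology L] {r : ℝ} {p : ℂ} :
    p ∈ latticePts L r ↔ p ∈ L ∧ ‖p‖ ≤ r := by simp [latticePts]

theorem mem_gridPts (L : Submodule ℤ ℂ) [DiscreteTopology L] {z₀ : ℂ} {r : ℝ} {z : ℂ} :
    z ∈ gridPts L z₀ r ↔ z ∈ grid L z₀ ∧ 0 < ‖z‖ ∧ ‖z‖ ≤ r := by
  simp only [gridPts, Set.Finite.mem_toFinset, Set.mem_ofPred_eq]

theorem add_mem_grid {L : Submodule ℤ ℂ} {z₀ m p : ℂ} (hm : m ∈ grid L z₀) (hp : p ∈ L) :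
    m + p ∈ grid L z₀ := by
  obtain ⟨q, hq, rfl⟩ := hm
  exact ⟨q + p, L.add_mem hq hp, by ring⟩

theorem sub_mem_of_mem_grid {L : Submodule ℤ ℂ} {z₀ m n : ℂ} (hn : n ∈ grid L z₀)
    (hm : m ∈ grid L z₀) : n - m ∈ L := by
  obtain ⟨q, hq, rfl⟩ := hm
  obtain ⟨p, hp, rfl⟩ := hn
  simpa using L.sub_mem hp hq

theorem grid_zero (L : Submodule ℤ ℂ) : grid L 0 = L := by simp [grid]

theorem exists_pos_le_norm (L : Submodule ℤ ℂ) [DiscreteTopology L] :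
    ∃ δ : ℝ, 0 < δ ∧ ∀ p ∈ L, p ≠ 0 → δ ≤ ‖p‖ := by
  by_cases h : ((latticePts L 1).erase 0).Nonempty
  · obtain ⟨q, hq, hmin⟩ := Finset.exists_min_image _ (fun p => ‖p‖) h
    rw [Finset.mem_erase, mem_latticePts] at hq
    refine ⟨‖q‖, norm_pos_iff.2 hq.1, fun p hp hp0 => ?_⟩
    by_cases hp1 : ‖p‖ ≤ 1
    · exact hmin p (by rw [Finset.mem_erase, mem_latticePts]; exact ⟨hp0, hp, hp1⟩)
    · linarith [hq.2.2]
  · refine ⟨1, one_pos, fun p hp hp0 => ?_⟩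
    by_contra hlt
    exact h ⟨p, by rw [Finset.mem_erase, mem_latticePts]; exact ⟨hp0, hp, by linarith⟩⟩

/-- The step map sending a point to the base point of its cell, for a tiling of the plane by the
translates of a fundamental domain. -/
theorem exists_cell (L : Submodule ℤ ℂ) [DiscreteTopology L] [IsZLattice ℝ L] :
    ∃ ρ : ℝ, 0 < ρ ∧ ∀ z₀ : ℂ, ∃ cell : ℂ → ℂ, (∀ w, cell w ∈ grid L z₀) ∧
      (∀ w, ‖w - cell w‖ ≤ ρ) ∧
      ∀ (G : Finset ℂ) (a : ℂ → ℂ), (∀ m ∈ G, m ∈ grid L z₀) → (∀ m ∈ grid L z₀, m ∉ G → a m = 0) →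
        Integrable (fun w => a (cell w)) ∧
          ∫ w, a (cell w) = ZLattice.covolume L * ∑ m ∈ G, a m := by
  have hfin := ZLattice.module_finite ℝ L
  have hfree := ZLattice.module_free ℝ L
  set b₀ := Module.Free.chooseBasis ℤ L
  set b := b₀.ofZLatticeBasis ℝ L
  have hspan : Submodule.span ℤ (Set.range b) = L := b₀.ofZLatticeBasis_span ℝ
  set D := ZSpan.fundamentalDomain b
  have hDm : MeasurableSet D := ZSpan.fundamentalDomain_measurableSet b
  have hvol : volume.real D = ZLattice.covolume L :=
    (ZLattice.covolume_eq_measure_fundamentalDomain L volume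
      (ZLattice.isAddFundamentalDomain b₀ volume)).symm
  have hDfin : volume D < ⊤ := (ZSpan.fundamentalDomain_isBounded b).measure_lt_top
  have hfl : ∀ w, (ZSpan.floor b w : ℂ) ∈ L := fun w => hspan.le (ZSpan.floor b w).2
  -- The fractional part has norm at most `∑ i, ‖b i‖`; the extra 1 only makes positivity evident.
  refine ⟨∑ i, ‖b i‖ + 1, by positivity, fun z₀ => ⟨fun w => z₀ + ZSpan.floor b (w - z₀),
    fun w => ⟨_, hfl _, rfl⟩, fun w => ?_, fun G a hG ha => ?_⟩⟩
  · have : w - (z₀ + ZSpan.floor b (w - z₀)) = ZSpan.fract b (w - z₀) := by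
      rw [ZSpan.fract_apply]; ring
    rw [this]
    linarith [ZSpan.norm_fract_le b (w - z₀)]
  -- The cell of `m` is the translate `m + D`, so `a ∘ cell` is a finite sum of indicators of sets
  -- of measure covol.
  · have key : ∀ m ∈ grid L z₀, ∀ w, (z₀ + ZSpan.floor b (w - z₀) = m ↔ w - m ∈ D) := by
      intro m hm w
      obtain ⟨q, hq, rfl⟩ := hm
      have hq' : -q ∈ Submodule.span ℤ (Set.range b) := by rw [hspan]; exact L.neg_mem hq
      have e1 : ZSpan.fract b (w - (z₀ + q)) = ZSpan.fract b (w - z₀) := by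
        rw [← ZSpan.fract_add_ZSpan b (w - z₀) hq']; congr 1; ring
      show _ ↔ w - (z₀ + q) ∈ ZSpan.fundamentalDomain b
      rw [← ZSpan.fract_eq_self, e1, ZSpan.fract_apply]
      constructor
      · intro h; linear_combination -h
      · intro h
        linear_combination -h
    have hfun : (fun w => a (z₀ + ZSpan.floor b (w - z₀)))
        = fun w => ∑ m ∈ G, Set.indicator ((fun w => w - m) ⁻¹' D) (fun _ => a m) w := by
      funext w
      set c : ℂ := z₀ + ZSpan.floor b (w - z₀) with hc
      have hcg : c ∈ grid L z₀ := ⟨_, hfl _, rfl⟩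
      have : ∀ m ∈ G, Set.indicator ((fun w => w - m) ⁻¹' D) (fun _ => a m) w
          = if c = m then a m else 0 := by
        intro m hm
        classical
        rw [Set.indicator_apply]
        exact if_congr (key m (hG m hm) w).symm rfl rfl
      rw [Finset.sum_congr rfl this, Finset.sum_ite_eq]
      split_ifs with h
      · rfl
      · exact ha c hcg h
    have hmeas : ∀ m : ℂ, MeasurableSet ((fun w => w - m) ⁻¹' D) := fun m =>
      (measurable_id.sub_const m) hDm
    have hv : ∀ m : ℂ, volume ((fun w => w - m) ⁻¹' D) = volume D := fun m =>
      by
      simp [sub_eq_add_neg]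
    have hint : ∀ m ∈ G, Integrable (Set.indicator ((fun w => w - m) ⁻¹' D) (fun _ => a m)) := by
      intro m _
      rw [integrable_indicator_iff (hmeas m)]
      exact integrableOn_const (by rw [hv]; exact hDfin.ne)
    show Integrable (fun w => a (z₀ + ZSpan.floor b (w - z₀))) ∧
      ∫ w, a (z₀ + ZSpan.floor b (w - z₀)) = _
    rw [hfun]
    refine ⟨integrable_finsetSum _ hint, ?_⟩
    rw [integral_finsetSum _ hint, Finset.mul_sum]
    refine Finset.sum_congr rfl fun m _ => ?_
    rw [integral_indicator_const _ (hmeas m), ← hvol, measureReal_def, hv, ← measureReal_def]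
    simp

/-- The normalized sum is itself the integral of the step function `a ∘ cell`, so a pointwise bound
integrates. Point counts, sums over m and sums over p are all compared with integrals in this way.
-/
theorem norm_covolume_mul_sum_sub_integral_le {L : Submodule ℤ ℂ} [DiscreteTopology L]
    {cell : ℂ → ℂ} {G : Finset ℂ} {a b : ℂ → ℂ} {g : ℂ → ℝ}
    (hcell : Integrable (fun w => a (cell w)) ∧
          ∫ w, a (cell w) = ZLattice.covolume L * ∑ m ∈ G, a m)
    (hb : Integrable b) (hg : Integrable g) (h : ∀ w, ‖a (cell w) - b w‖ ≤ g w) :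
    ‖ZLattice.covolume L * ∑ m ∈ G, a m - ∫ w, b w‖ ≤ ∫ w, g w := by
  rw [← hcell.2, ← integral_sub hcell.1 hb]
  exact norm_integral_le_of_norm_le hg (ae_of_all _ h)

theorem volumeReal_closedBall (z : ℂ) {r : ℝ} (hr : 0 ≤ r) :
    volume.real (Metric.closedBall z r) = Real.pi * r ^ 2 := by
  rw [measureReal_def, Complex.volume_closedBall, ENNReal.toReal_mul, ENNReal.toReal_pow,
    ENNReal.toReal_ofReal hr, mul_comm]
  simp

/-- The cells of the points counted lie in the disk of radius `R + ρ`. Removing 0 avoids a constant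
term: the set is empty unless `R ≥ δ`, and then `ρ ≤ (ρ / δ) R`. Small `R` does occur later. -/
theorem exists_card_latticePts_le (L : Submodule ℤ ℂ) [DiscreteTopology L] [IsZLattice ℝ L] :
    ∃ C : ℝ, 0 < C ∧ ∀ R : ℝ, 0 < R → (((latticePts L R).erase 0).card : ℝ) ≤ C * R ^ 2 := by
  obtain ⟨δ, hδ, hmin⟩ := exists_pos_le_norm L
  obtain ⟨ρ, hρ, hcell⟩ := exists_cell L
  obtain ⟨cell, hc1, hc2, hc3⟩ := hcell 0
  have hcov := ZLattice.covolume_pos L volume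
  refine ⟨Real.pi * (1 + ρ / δ) ^ 2 / ZLattice.covolume L, by positivity, fun R hR => ?_⟩
  rcases ((latticePts L R).erase 0).eq_empty_or_nonempty with he | ⟨q, hq⟩
  · rw [he]; simp; positivity
  rw [Finset.mem_erase, mem_latticePts] at hq
  have hδR : δ ≤ R := (hmin q hq.2.1 hq.1).trans hq.2.2
  set G := (latticePts L R).erase 0 with hGdef
  have hint := hc3 G (fun m => if m ∈ G then 1 else 0)
    (fun m hm => by
      rw [hGdef, Finset.mem_erase, mem_latticePts] at hm; rw [grid_zero]; exact hm.2.1)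
    (fun m _ hm => by simp [hm])
  have hB : IntegrableOn (fun _ : ℂ => (1 : ℝ)) (Metric.closedBall 0 (R + ρ)) :=
    integrableOn_const measure_closedBall_lt_top.ne
  have := norm_covolume_mul_sum_sub_integral_le (a := fun m => if m ∈ G then 1 else 0) (b := fun _ => 0)
    (g := Set.indicator (Metric.closedBall 0 (R + ρ)) (fun _ => 1)) hint (integrable_zero _ _ _)
    ((integrable_indicator_iff measurableSet_closedBall).2 hB) (by
      intro w
      by_cases hw : cell w ∈ G
      · have h1 : ‖cell w‖ ≤ R := by
          rw [hGdef, Finset.mem_erase, mem_latticePts] at hw; exact hw.2.2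
        have h2 : w ∈ Metric.closedBall (0 : ℂ) (R + ρ) := by
          rw [mem_closedBall_zero_iff]
          calc ‖w‖ = ‖cell w + (w - cell w)‖ := by ring_nf
            _ ≤ ‖cell w‖ + ‖w - cell w‖ := norm_add_le _ _
            _ ≤ _ := add_le_add h1 (hc2 w)
        simp [hw, Set.indicator_of_mem h2]
      · simp only [hw, if_false, sub_zero, norm_zero]
        exact Set.indicator_nonneg (fun _ _ => zero_le_one) _)
  rw [integral_indicator_const _ measurableSet_closedBall, volumeReal_closedBall _ (by positivity)]
    at this
  simp only [integral_zero, sub_zero, Finset.sum_ite_mem, Finset.inter_self, Finset.sum_const,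
    nsmul_eq_mul, mul_one, norm_mul, Complex.norm_real, Real.norm_eq_abs, abs_of_pos hcov,
    Complex.norm_natCast, smul_eq_mul] at this
  rw [div_mul_eq_mul_div, le_div_iff₀ hcov, mul_comm]
  refine this.trans ?_
  have h3 : R + ρ ≤ (1 + ρ / δ) * R := by
    have : ρ ≤ ρ / δ * R := by
      rw [div_mul_eq_mul_div, le_div_iff₀ hδ]; gcongr
    linarith
  calc Real.pi * (R + ρ) ^ 2 ≤ Real.pi * ((1 + ρ / δ) * R) ^ 2 := by gcongr
    _ = _ := by ring

/-! ### Level arguments and level powers. -/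

/-- The argument of `z` in `[2πk, 2π(k+1)[`. -/
noncomputable def lvlArg (k : ℤ) (z : ℂ) : ℝ := toIcoMod Real.two_pi_pos (2 * Real.pi * (k : ℝ)) z.arg

theorem levelPow_eq_lvlArg (β : ℝ) (k : ℤ) (z : ℂ) :
    levelPow β k z = ((‖z‖ ^ β : ℝ) : ℂ) * Complex.exp (Complex.I * ((β * lvlArg k z : ℝ) : ℂ)) := by
  rw [levelPow, ← lvlArg]; push_cast; ring_nf

theorem lvlArg_mem (k : ℤ) (z : ℂ) :
    2 * Real.pi * k ≤ lvlArg k z ∧ lvlArg k z < 2 * Real.pi * k + 2 * Real.pi :=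
  toIcoMod_mem_Ico Real.two_pi_pos _ _

/-- The principal argument lies in ]-π, π] and is negative exactly in the open lower half-plane,
where one more turn is needed. The number of turns is thus constant on each open half-plane. -/
theorem lvlArg_eq (k : ℤ) (z : ℂ) :
    lvlArg k z = z.arg + 2 * Real.pi * ((if z.im < 0 then k + 1 else k : ℤ) : ℝ) := by
  rw [lvlArg, toIcoMod_eq_iff]
  have h1 := Complex.neg_pi_lt_arg z
  have h2 := Complex.arg_le_pi z
  have hpi := Real.pi_pos
  split_ifs with h
  · have h3 := Complex.arg_neg_iff.2 h
    refine ⟨⟨?_, ?_⟩, -(k + 1), ?_⟩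
    · push_cast; linarith
    · push_cast; linarith
    · simp; ring
  · have h3 := Complex.arg_nonneg_iff.2 (not_lt.1 h)
    refine ⟨⟨?_, ?_⟩, -k, ?_⟩
    · linarith
    · linarith
    · simp; ring

theorem norm_mul_exp_lvlArg (k : ℤ) (z : ℂ) :
    (‖z‖ : ℂ) * Complex.exp (Complex.I * (lvlArg k z : ℂ)) = z := by
  rw [lvlArg_eq]
  set j : ℤ := if z.im < 0 then k + 1 else k
  have : Complex.I * ((z.arg + 2 * Real.pi * (j : ℝ) : ℝ) : ℂ)
      = z.arg * Complex.I + j * (2 * Real.pi * Complex.I) := by push_cast; ring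
  rw [this, Complex.exp_add, Complex.exp_int_mul_two_pi_mul_I, mul_one]
  exact Complex.norm_mul_exp_arg_mul_I z

theorem norm_exp_I_mul_ofReal (x : ℝ) : ‖Complex.exp (Complex.I * x)‖ = 1 := by
  rw [mul_comm]; exact Complex.norm_exp_ofReal_mul_I x

theorem norm_levelPow (β : ℝ) (k : ℤ) (z : ℂ) : ‖levelPow β k z‖ = ‖z‖ ^ β := by
  rw [levelPow_eq_lvlArg, norm_mul, norm_exp_I_mul_ofReal, mul_one, Complex.norm_real,
    Real.norm_eq_abs, abs_of_nonneg (by positivity)]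

theorem levelPow_eq_cpow (β : ℝ) (k : ℤ) {z : ℂ} (hz : z ≠ 0) :
    levelPow β k z = Complex.exp (Complex.I * ((β * (2 * Real.pi *
      ((if z.im < 0 then k + 1 else k : ℤ) : ℝ)) : ℝ) : ℂ)) * z ^ (β : ℂ) := by
  rw [levelPow_eq_lvlArg, lvlArg_eq, Complex.cpow_def_of_ne_zero hz, Complex.log,
    Real.rpow_def_of_pos (norm_pos_iff.2 hz), Complex.ofReal_exp, ← Complex.exp_add,
    ← Complex.exp_add]
  congr 1
  push_cast
  ring

theorem measurable_lvlArg (k : ℤ) : Measurable (lvlArg k) := by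
  have : lvlArg k = fun z => if z.im < 0 then z.arg + 2 * Real.pi * ((k + 1 : ℤ) : ℝ)
      else z.arg + 2 * Real.pi * (k : ℝ) := by
    funext z
    rw [lvlArg_eq]
    split_ifs <;> rfl
  rw [this]
  exact Measurable.ite (measurableSet_lt Complex.measurable_im measurable_const)
    (Complex.measurable_arg.add_const _) (Complex.measurable_arg.add_const _)

theorem measurable_levelPow (β : ℝ) (k : ℤ) : Measurable (levelPow β k) := by
  have : levelPow β k = fun z => ((‖z‖ ^ β : ℝ) : ℂ) *
      Complex.exp (Complex.I * ((β * lvlArg k z : ℝ) : ℂ)) := by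
    funext z; exact levelPow_eq_lvlArg β k z
  rw [this]
  have h := measurable_lvlArg k
  fun_prop

/-! ### Separation of level powers. -/

theorem rpow_tangent_le {α x y : ℝ} (hα0 : 0 < α) (hα1 : α < 1) (hx : 0 < x) (hy : 0 ≤ y) :
    α * x ^ (α - 1) * (x - y) ≤ x ^ α - y ^ α := by
  have h := rpow_one_add_le_one_add_mul_self (s := y / x - 1)
    (by have : 0 ≤ y / x := by positivity
        linarith) hα0.le hα1.le
  rw [add_sub_cancel, Real.div_rpow hy hx.le, div_le_iff₀ (by positivity)] at h
  rw [Real.rpow_sub hx, Real.rpow_one]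
  have : (1 + α * (y / x - 1)) * x ^ α = x ^ α - α * (x ^ α / x) * (x - y) := by
    field_simp; ring
  linarith

/-- The right side is 2 sin(α|δ|/2), and sine on [0, πα] lies above its chord by concavity. Since α
< 1, sin(πα) > 0: points on the two sides of the cut, with |δ| near 2π, have powers far apart. -/
theorem mul_abs_le_norm_exp_sub_one {α δ : ℝ} (hα0 : 0 < α) (hα1 : α < 1)
    (hδ : |δ| < 2 * Real.pi) :
    Real.sin (Real.pi * α) / Real.pi * |δ| ≤ ‖Complex.exp (Complex.I * ((α * δ : ℝ) : ℂ)) - 1‖ := by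
  have hpi := Real.pi_pos
  rw [Complex.norm_exp_I_mul_ofReal_sub_one, Real.norm_eq_abs, abs_mul, abs_two]
  have h1 : |Real.sin (α * δ / 2)| = Real.sin (α * |δ| / 2) := by
    have h0 : 0 ≤ Real.sin (α * |δ| / 2) := by
      refine Real.sin_nonneg_of_nonneg_of_le_pi (by positivity) ?_
      nlinarith [abs_nonneg δ]
    rcases abs_cases δ with ⟨h, _⟩ | ⟨h, _⟩
    · rw [h] at h0 ⊢; exact abs_of_nonneg h0
    · rw [h] at h0 ⊢
      have : α * -δ / 2 = -(α * δ / 2) := by ring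
      rw [this, Real.sin_neg] at h0 ⊢
      rw [abs_of_nonpos (by linarith)]
  rw [h1]
  have hconc := strictConcaveOn_sin_Icc.concaveOn
  have ht0 : 0 ≤ |δ| / (2 * Real.pi) := by positivity
  have ht1 : |δ| / (2 * Real.pi) ≤ 1 := by rw [div_le_one (by positivity)]; exact hδ.le
  have := hconc.2 (x := Real.pi * α) (y := 0) ⟨by positivity, by nlinarith⟩
    ⟨le_rfl, hpi.le⟩ ht0 (sub_nonneg.2 ht1) (by ring)
  simp only [smul_eq_mul, mul_zero, add_zero, Real.sin_zero] at this
  have e : |δ| / (2 * Real.pi) * (Real.pi * α) = α * |δ| / 2 := by field_simp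
  rw [e] at this
  calc Real.sin (Real.pi * α) / Real.pi * |δ|
      = 2 * (|δ| / (2 * Real.pi) * Real.sin (Real.pi * α)) := by field_simp
    _ ≤ _ := by gcongr

/-- For |m| ≤ |n|, the distance D of the powers controls the gap in moduli, by concavity of x ↦ x^α,
and the gap δ in angles, by the previous lemma. Together these two gaps bound |n - m|. -/
theorem exists_levelPow_separation {α : ℝ} (hα0 : 0 < α) (hα1 : α < 1) :
    ∃ c : ℝ, 0 < c ∧ ∀ (k : ℤ) (n m : ℂ), n ≠ 0 → m ≠ 0 →
      c * ‖n - m‖ * (max ‖n‖ ‖m‖) ^ (α - 1) ≤ ‖levelPow α k n - levelPow α k m‖ := by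
  have hpi := Real.pi_pos
  set c₁ := Real.sin (Real.pi * α) / Real.pi with hc₁
  have hc₁0 : 0 < c₁ := by
    refine div_pos (Real.sin_pos_of_pos_of_lt_pi (by positivity) (by nlinarith)) hpi
  have key : ∀ (k : ℤ) (n m : ℂ), n ≠ 0 → m ≠ 0 → ‖m‖ ≤ ‖n‖ →
      (1 / (1 / α + 2 / c₁)) * ‖n - m‖ * ‖n‖ ^ (α - 1) ≤ ‖levelPow α k n - levelPow α k m‖ := by
    intro k n m hn hm hmn
    set x := ‖n‖ with hx
    set y := ‖m‖ with hy
    have hx0 : 0 < x := norm_pos_iff.2 hn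
    have hy0 : 0 < y := norm_pos_iff.2 hm
    set δ := lvlArg k m - lvlArg k n with hδ
    have hδ2 : |δ| < 2 * Real.pi := by
      have h1 := lvlArg_mem k m
      have h2 := lvlArg_mem k n
      rw [abs_lt]; constructor <;> linarith [h1.1, h1.2, h2.1, h2.2]
    -- Removing the common phase leaves only the angle difference. The case β = 1 recovers n - m and
    -- β = α gives the powers.
    have factor : ∀ β s t : ℝ, ‖(s : ℂ) * Complex.exp (Complex.I * ((β * lvlArg k n : ℝ) : ℂ))
        - t * Complex.exp (Complex.I * ((β * lvlArg k m : ℝ) : ℂ))‖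
        = ‖(s : ℂ) - t * Complex.exp (Complex.I * ((β * δ : ℝ) : ℂ))‖ := by
      intro β s t
      have : (s : ℂ) * Complex.exp (Complex.I * ((β * lvlArg k n : ℝ) : ℂ))
        - t * Complex.exp (Complex.I * ((β * lvlArg k m : ℝ) : ℂ))
        = Complex.exp (Complex.I * ((β * lvlArg k n : ℝ) : ℂ)) *
          ((s : ℂ) - t * Complex.exp (Complex.I * ((β * δ : ℝ) : ℂ))) := by
        rw [mul_sub, mul_left_comm _ (t : ℂ), ← Complex.exp_add]
        have : Complex.I * ((β * lvlArg k n : ℝ) : ℂ) + Complex.I * ((β * δ : ℝ) : ℂ)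
          = Complex.I * ((β * lvlArg k m : ℝ) : ℂ) := by rw [hδ]; push_cast; ring
        rw [this]; ring
      rw [this, norm_mul, norm_exp_I_mul_ofReal, one_mul]
    have hnm : ‖n - m‖ ≤ (x - y) + x * |δ| := by
      have h := factor 1 x y
      rw [one_mul, one_mul, one_mul, hx, hy, norm_mul_exp_lvlArg, norm_mul_exp_lvlArg, ← hx,
        ← hy] at h
      rw [h]
      have e : (x : ℂ) - y * Complex.exp (Complex.I * (δ : ℂ))
          = ((x - y : ℝ) : ℂ) - y * (Complex.exp (Complex.I * (δ : ℂ)) - 1) := by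
        push_cast; ring
      rw [e]
      refine (norm_sub_le _ _).trans ?_
      rw [Complex.norm_real, Real.norm_eq_abs, abs_of_nonneg (sub_nonneg.2 hmn), norm_mul,
        Complex.norm_real, Real.norm_eq_abs, abs_of_pos hy0]
      have := Real.norm_exp_I_mul_ofReal_sub_one_le (x := δ)
      gcongr
      simpa using this
    have hD : ‖levelPow α k n - levelPow α k m‖
        = ‖((x ^ α : ℝ) : ℂ) - ((y ^ α : ℝ) : ℂ) * Complex.exp (Complex.I * ((α * δ : ℝ) : ℂ))‖ := by
      rw [levelPow_eq_lvlArg, levelPow_eq_lvlArg, factor]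
    set D := ‖levelPow α k n - levelPow α k m‖
    set E := Complex.exp (Complex.I * ((α * δ : ℝ) : ℂ)) with hE
    have hEn : ‖E‖ = 1 := norm_exp_I_mul_ofReal _
    have hyx : y ^ α ≤ x ^ α := by gcongr
    have hD1 : x ^ α - y ^ α ≤ D := by
      rw [hD]
      refine le_trans (le_of_eq ?_) (norm_sub_norm_le _ _)
      rw [norm_mul, hEn, Complex.norm_real, Complex.norm_real, Real.norm_eq_abs, Real.norm_eq_abs,
        abs_of_nonneg (by positivity), abs_of_nonneg (by positivity), mul_one]
    have hD2 : x ^ α * (c₁ * |δ|) ≤ 2 * D := by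
      have h1 := mul_abs_le_norm_exp_sub_one hα0 hα1 hδ2
      have h2 : ((x ^ α : ℝ) : ℂ) * (E - 1) = (((x ^ α - y ^ α : ℝ)) : ℂ) * E
          - (((x ^ α : ℝ) : ℂ) - ((y ^ α : ℝ) : ℂ) * E) := by push_cast; ring
      have h3 := norm_sub_le ((((x ^ α - y ^ α : ℝ)) : ℂ) * E)
        (((x ^ α : ℝ) : ℂ) - ((y ^ α : ℝ) : ℂ) * E)
      rw [← h2, ← hD, norm_mul, norm_mul, hEn, Complex.norm_real, Complex.norm_real,
        Real.norm_eq_abs, Real.norm_eq_abs, abs_of_nonneg (by positivity),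
        abs_of_nonneg (sub_nonneg.2 hyx), mul_one] at h3
      have h4 : x ^ α * (c₁ * |δ|) ≤ x ^ α * ‖E - 1‖ := by gcongr
      linarith
    have hD3 := (rpow_tangent_le hα0 hα1 hx0 hy0.le).trans hD1
    have hx1 : x ^ (α - 1) * x = x ^ α := by
      rw [Real.rpow_sub hx0, Real.rpow_one]; field_simp
    have hxa : 0 < x ^ (α - 1) := by positivity
    rw [mul_assoc, div_mul_eq_mul_div, one_mul, div_le_iff₀ (by positivity)]
    have t1 : x ^ (α - 1) * (x - y) ≤ D * (1 / α) := by
      rw [mul_one_div, le_div_iff₀ hα0]; linarith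
    have t2 : x ^ α * |δ| ≤ D * (2 / c₁) := by
      rw [mul_div_assoc', le_div_iff₀ hc₁0]; linarith
    calc ‖n - m‖ * x ^ (α - 1) ≤ ((x - y) + x * |δ|) * x ^ (α - 1) := by gcongr
      _ = x ^ (α - 1) * (x - y) + x ^ (α - 1) * x * |δ| := by ring
      _ ≤ D * (1 / α + 2 / c₁) := by rw [hx1]; linarith
  refine ⟨1 / (1 / α + 2 / c₁), by positivity, fun k n m hn hm => ?_⟩
  rcases le_total ‖m‖ ‖n‖ with h | h
  · rw [max_eq_left h]; exact key k n m hn hm h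
  · rw [max_eq_right h, norm_sub_rev n m, norm_sub_rev (levelPow α k n)]
    exact key k m n hm hn h

/-! ### Linearization of level powers away from the real axis. -/

/-- The condition `r < |w.im|` keeps the ball off the real axis, hence in the slit plane. The mean
value inequality is applied to z ↦ z^{α-1}, then to z ↦ z^α minus its linear part at w. -/
theorem norm_cpow_sub_tangent_le {α : ℝ} (hα0 : 0 < α) (hα1 : α < 1) {w : ℂ} {r : ℝ}
    (h1 : r < |w.im|) (h2 : r ≤ ‖w‖ / 2) {x y : ℂ} (hx : x ∈ Metric.closedBall w r)
    (hy : y ∈ Metric.closedBall w r) :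
    ‖x ^ (α : ℂ) - y ^ (α : ℂ) - α * w ^ ((α - 1 : ℝ) : ℂ) * (x - y)‖
      ≤ 4 * ‖w‖ ^ (α - 2) * r * ‖x - y‖ := by
  have hr : 0 ≤ r := Metric.nonneg_of_mem_closedBall hx
  have him : ∀ z ∈ Metric.closedBall w r, z ∈ Complex.slitPlane := by
    intro z hz
    refine Complex.mem_slitPlane_iff.2 (Or.inr fun h0 => ?_)
    rw [mem_closedBall_iff_norm] at hz
    have := (Complex.abs_im_le_norm (z - w)).trans hz
    rw [Complex.sub_im, h0, zero_sub, abs_neg] at this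
    linarith
  have hwr : w ∈ Metric.closedBall w r := Metric.mem_closedBall_self hr
  have hw0 : 0 < ‖w‖ := by
    have := Complex.abs_im_le_norm w
    linarith
  -- Here |z| ≥ |w|/2, and the factor 4 bounds 2^{2-α}.
  have hlow : ∀ z ∈ Metric.closedBall w r, ‖z‖ ^ (α - 2) ≤ 4 * ‖w‖ ^ (α - 2) := by
    intro z hz
    rw [mem_closedBall_iff_norm'] at hz
    have h3 : ‖w‖ / 2 ≤ ‖z‖ := by
      have := norm_sub_norm_le w z
      linarith
    calc ‖z‖ ^ (α - 2) ≤ (‖w‖ / 2) ^ (α - 2) :=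
          Real.rpow_le_rpow_of_nonpos (by positivity) h3 (by linarith)
      _ = ‖w‖ ^ (α - 2) * 2 ^ (2 - α) := by
          rw [Real.div_rpow hw0.le two_pos.le, div_eq_mul_inv, ← Real.rpow_neg two_pos.le, neg_sub]
      _ ≤ ‖w‖ ^ (α - 2) * 2 ^ (2 : ℝ) := by
          gcongr
          · norm_num
          · linarith
      _ = _ := by norm_num; ring
  have hd : ∀ (c : ℝ) (z : ℂ), z ∈ Metric.closedBall w r →
      HasDerivAt (fun z : ℂ => z ^ (c : ℂ)) (c * z ^ ((c - 1 : ℝ) : ℂ)) z := by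
    intro c z hz
    have := (hasDerivAt_id z).cpow_const (c := (c : ℂ)) (him z hz)
    simpa using this
  have hfirst : ∀ z ∈ Metric.closedBall w r,
      ‖z ^ ((α - 1 : ℝ) : ℂ) - w ^ ((α - 1 : ℝ) : ℂ)‖ ≤ 4 * ‖w‖ ^ (α - 2) * r := by
    intro z hz
    refine ((convex_closedBall w r).norm_image_sub_le_of_norm_hasDerivWithin_le (𝕜 := ℂ)
      (fun z hz => (hd (α - 1) z hz).hasDerivWithinAt) (C := 4 * ‖w‖ ^ (α - 2)) ?_ hwr hz).trans ?_
    · intro u hu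
      have h0 : u ≠ 0 := Complex.slitPlane_ne_zero (him u hu)
      rw [norm_mul, Complex.norm_real, Real.norm_eq_abs, Complex.norm_cpow_real]
      have : |α - 1| ≤ 1 := by rw [abs_le]; constructor <;> linarith
      have h3 := hlow u hu
      have e : α - 1 - 1 = α - 2 := by ring
      rw [e]
      calc |α - 1| * ‖u‖ ^ (α - 2) ≤ 1 * ‖u‖ ^ (α - 2) := by gcongr
        _ ≤ _ := by linarith
    · rw [mem_closedBall_iff_norm] at hz
      gcongr
  have := (convex_closedBall w r).norm_image_sub_le_of_norm_hasDerivWithin_le (𝕜 := ℂ)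
      (f := fun z => z ^ (α : ℂ) - α * w ^ ((α - 1 : ℝ) : ℂ) * z)
      (f' := fun z => α * z ^ ((α - 1 : ℝ) : ℂ) - α * w ^ ((α - 1 : ℝ) : ℂ) * 1)
      (fun z hz => ((hd α z hz).sub ((hasDerivAt_id z).const_mul _)).hasDerivWithinAt)
      (C := 4 * ‖w‖ ^ (α - 2) * r) (fun z hz => by
        rw [mul_one, ← mul_sub, norm_mul, Complex.norm_real, Real.norm_eq_abs, abs_of_pos hα0]
        exact (mul_le_of_le_one_left (norm_nonneg _) hα1.le).trans (hfirst z hz)) hy hx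
  refine le_trans (le_of_eq ?_) this
  congr 1
  ring

/-- The ball stays in one open half-plane, where the level power is the principal power times a
constant phase. -/
theorem norm_levelPow_sub_tangent_le {α : ℝ} (hα0 : 0 < α) (hα1 : α < 1) (k : ℤ) {w : ℂ} {r : ℝ}
    (h1 : r < |w.im|) (h2 : r ≤ ‖w‖ / 2) {x y : ℂ} (hx : x ∈ Metric.closedBall w r)
    (hy : y ∈ Metric.closedBall w r) :
    ‖levelPow α k x - levelPow α k y - α * levelPow (α - 1) k w * (x - y)‖
      ≤ 4 * ‖w‖ ^ (α - 2) * r * ‖x - y‖ := by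
  have hr : 0 ≤ r := Metric.nonneg_of_mem_closedBall hx
  have hwr : w ∈ Metric.closedBall w r := Metric.mem_closedBall_self hr
  have him : ∀ z ∈ Metric.closedBall w r, z ≠ 0 ∧ (z.im < 0 ↔ w.im < 0) := by
    intro z hz
    rw [mem_closedBall_iff_norm] at hz
    have := (Complex.abs_im_le_norm (z - w)).trans hz
    rw [Complex.sub_im, abs_le] at this
    refine ⟨?_, ?_⟩
    · rintro rfl
      rw [Complex.zero_im, zero_sub] at this
      rcases abs_cases w.im with h | h <;> linarith [this.1, this.2]
    · rcases abs_cases w.im with h | h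
      · exact ⟨fun _ => by linarith, fun _ => by linarith⟩
      · exact ⟨fun _ => by linarith, fun _ => by linarith⟩
  rw [levelPow_eq_cpow α k (him x hx).1, levelPow_eq_cpow α k (him y hy).1,
    levelPow_eq_cpow (α - 1) k (him w hwr).1]
  simp only [(him x hx).2, (him y hy).2]
  set j : ℤ := if w.im < 0 then k + 1 else k
  -- The phases for α - 1 and α agree because they differ by whole turns.
  have e : Complex.exp (Complex.I * (((α - 1) * (2 * Real.pi * (j : ℝ)) : ℝ) : ℂ))
      = Complex.exp (Complex.I * ((α * (2 * Real.pi * (j : ℝ)) : ℝ) : ℂ)) := by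
    rw [← mul_one (Complex.exp (Complex.I * ((α * (2 * Real.pi * (j : ℝ)) : ℝ) : ℂ))),
      ← Complex.exp_int_mul_two_pi_mul_I (-j), ← Complex.exp_add]
    congr 1; push_cast; ring
  rw [e]
  set u := Complex.exp (Complex.I * ((α * (2 * Real.pi * (j : ℝ)) : ℝ) : ℂ))
  have : u * x ^ (α : ℂ) - u * y ^ (α : ℂ) - α * (u * w ^ ((α - 1 : ℝ) : ℂ)) * (x - y)
      = u * (x ^ (α : ℂ) - y ^ (α : ℂ) - α * w ^ ((α - 1 : ℝ) : ℂ) * (x - y)) := by ring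
  rw [this, norm_mul, norm_exp_I_mul_ofReal, one_mul]
  exact norm_cpow_sub_tangent_le hα0 hα1 h1 h2 hx hy

/-! ### Radial integrals and the measure of the exceptional set. -/

theorem integral_norm_eq (g : ℝ → ℝ) :
    ∫ z : ℂ, g ‖z‖ = 2 * Real.pi * ∫ y in Set.Ioi (0 : ℝ), y * g y := by
  have h := integral_fun_norm_addHaar (volume : Measure ℂ) g
  have hb : volume.real (Metric.ball (0 : ℂ) 1) = Real.pi := by
    rw [measureReal_def, Complex.volume_ball]; simp
  rw [h, Complex.finrank_real_complex, hb]
  simp [mul_assoc]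

theorem integrableOn_norm_rpow {e : ℝ} (he : -2 < e) (N : ℝ) :
    IntegrableOn (fun z : ℂ => ‖z‖ ^ e) (Metric.closedBall 0 N) := by
  rcases lt_or_ge N 0 with hN | hN
  · simp [Metric.closedBall_eq_empty.2 hN]
  have h : IntegrableOn (fun z : ℂ => ‖z‖ ^ e) (Metric.ball 0 (N + 1)) := by
    rw [integrableOn_fun_norm_addHaar (volume : Measure ℂ) (f := fun y => y ^ e),
      Complex.finrank_real_complex]
    have h1 : IntegrableOn (fun y : ℝ => y ^ (e + 1)) (Set.Ioo 0 (N + 1)) :=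
      ((intervalIntegrable_iff_integrableOn_Ioc_of_le (by linarith)).1
        (intervalIntegral.intervalIntegrable_rpow' (by linarith))).mono_set
        Set.Ioo_subset_Ioc_self
    refine h1.congr_fun (fun y hy => ?_) measurableSet_Ioo
    simp only [Nat.add_one_sub_one, pow_one, smul_eq_mul]
    rw [Real.rpow_add hy.1, Real.rpow_one, mul_comm]
  exact h.mono_set (Metric.closedBall_subset_ball (by linarith))

theorem setIntegral_norm_rpow {e : ℝ} (he : -2 < e) {N : ℝ} (hN : 0 ≤ N) :
    ∫ z : ℂ in Metric.closedBall 0 N, ‖z‖ ^ e = 2 * Real.pi * N ^ (e + 2) / (e + 2) := by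
  rw [← integral_indicator measurableSet_closedBall]
  have h1 : (Metric.closedBall (0 : ℂ) N).indicator (fun z : ℂ => ‖z‖ ^ e)
      = fun z => (Set.Iic N).indicator (fun y : ℝ => y ^ e) ‖z‖ := by
    classical
    funext z
    simp only [Set.indicator_apply, mem_closedBall_zero_iff, Set.mem_Iic]
  rw [h1, integral_norm_eq]
  have h2 : ∀ y : ℝ, y ∈ Set.Ioi (0 : ℝ) → y * (Set.Iic N).indicator (fun y : ℝ => y ^ e) y
      = (Set.Iic N).indicator (fun y : ℝ => y ^ (e + 1)) y := by
    intro y hy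
    simp only [Set.indicator_apply]
    split_ifs
    · rw [Real.rpow_add hy, Real.rpow_one, mul_comm]
    · simp
  rw [setIntegral_congr_fun measurableSet_Ioi h2, setIntegral_indicator measurableSet_Iic,
    Set.Ioi_inter_Iic, ← intervalIntegral.integral_of_le hN,
    integral_rpow (Or.inl (by linarith))]
  have : e + 1 + 1 = e + 2 := by ring
  rw [this, Real.zero_rpow (by linarith)]
  ring

/-- The part of the disk of radius `N` at distance at most `r` from the real axis, together with
the annulus of width `2r` around the circle of radius `N`. -/
def badSet (N r : ℝ) : Set ℂ :=
  {w | ‖w‖ ≤ N ∧ |w.im| ≤ r} ∪ {w | N - r ≤ ‖w‖ ∧ ‖w‖ ≤ N + r}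

theorem measurableSet_badSet (N r : ℝ) : MeasurableSet (badSet N r) := by
  refine MeasurableSet.union ?_ ?_
  · exact (measurableSet_le measurable_norm measurable_const).inter
      (measurableSet_le (Complex.measurable_im.abs) measurable_const)
  · exact (measurableSet_le measurable_const measurable_norm).inter
      (measurableSet_le measurable_norm measurable_const)

/-- The strip fits in a 2N by 2r rectangle, and the annulus has area 4πNr ≤ 16Nr. -/
theorem volume_badSet_le {N r : ℝ} (hr : 0 ≤ r) (hrN : r ≤ N) :
    volume (badSet N r) ≤ ENNReal.ofReal (20 * N * r) := by
  have hN : 0 ≤ N := hr.trans hrN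
  have h1 : volume {w : ℂ | ‖w‖ ≤ N ∧ |w.im| ≤ r} ≤ ENNReal.ofReal (4 * N * r) := by
    have hs : {w : ℂ | ‖w‖ ≤ N ∧ |w.im| ≤ r} ⊆
        Complex.measurableEquivRealProd ⁻¹' (Set.Icc (-N) N ×ˢ Set.Icc (-r) r) := by
      rintro w ⟨h1, h2⟩
      exact ⟨abs_le.1 ((Complex.abs_re_le_norm w).trans h1), abs_le.1 h2⟩
    refine (measure_mono hs).trans ?_
    rw [Complex.volume_preserving_equiv_real_prod.measure_preimage
      (measurableSet_Icc.prod measurableSet_Icc).nullMeasurableSet, Measure.volume_eq_prod,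
      Measure.prod_prod, Real.volume_Icc, Real.volume_Icc, ← ENNReal.ofReal_mul (by linarith)]
    exact ENNReal.ofReal_le_ofReal (by nlinarith)
  have h2 : volume {w : ℂ | N - r ≤ ‖w‖ ∧ ‖w‖ ≤ N + r} ≤ ENNReal.ofReal (16 * N * r) := by
    have hs : {w : ℂ | N - r ≤ ‖w‖ ∧ ‖w‖ ≤ N + r} =
        Metric.closedBall 0 (N + r) \ Metric.ball 0 (N - r) := by
      ext w
      simp [and_comm]
    rw [hs, measure_sdiff ((Metric.ball_subset_ball (by linarith)).trans
      Metric.ball_subset_closedBall) measurableSet_ball.nullMeasurableSet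
      measure_ball_lt_top.ne, ← ofReal_measureReal measure_closedBall_lt_top.ne,
      ← ofReal_measureReal measure_ball_lt_top.ne, ← ENNReal.ofReal_sub _ measureReal_nonneg,
      volumeReal_closedBall _ (by linarith), measureReal_def, Complex.volume_ball,
      ENNReal.toReal_mul, ENNReal.toReal_pow, ENNReal.toReal_ofReal (by linarith)]
    refine ENNReal.ofReal_le_ofReal ?_
    simp only [ENNReal.coe_toReal, NNReal.coe_real_pi]
    have := Real.pi_le_four
    nlinarith [mul_nonneg hN hr]
  calc volume (badSet N r) ≤ _ := measure_union_le _ _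
    _ ≤ ENNReal.ofReal (4 * N * r) + ENNReal.ofReal (16 * N * r) := add_le_add h1 h2
    _ = ENNReal.ofReal (20 * N * r) := by
        rw [← ENNReal.ofReal_add (by positivity) (by positivity)]; ring_nf

/-! ### From pairs of grid points to integrals over the disk. -/

/-- The change of index is (n, m) ↦ (n - m, m). Only nonzero terms are matched, which lets
separation confine p to a disk. -/
theorem sum_pairs_eq {α : ℝ} {c : ℝ} (hc : 0 < c) (hα1 : α < 1) {k : ℤ}
    (hsep : ∀ (n m : ℂ), n ≠ 0 → m ≠ 0 →
      c * ‖n - m‖ * (max ‖n‖ ‖m‖) ^ (α - 1) ≤ ‖levelPow α k n - levelPow α k m‖)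
    (L : Submodule ℤ ℂ) [DiscreteTopology L] (z₀ : ℂ) {f : ℂ → ℂ} {A M : ℝ} (hf : IsTest f A M)
    {N φ : ℝ} (hN : 0 < N) (hφ : 0 < φ) :
    ∑ q ∈ (gridPts L z₀ N ×ˢ gridPts L z₀ N).filter (fun q => q.1 ≠ q.2),
        f ((φ : ℂ) * (levelPow α k q.1 - levelPow α k q.2))
      = ∑ p ∈ (latticePts L (A * N ^ (1 - α) / (c * φ))).erase 0, ∑ m ∈ gridPts L z₀ N,
        if m + p ∈ gridPts L z₀ N then f ((φ : ℂ) * (levelPow α k (m + p) - levelPow α k m))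
        else 0 := by
  rw [← Finset.sum_product', ← Finset.sum_filter]
  refine Finset.sum_bij_ne_zero (fun q _ _ => (q.1 - q.2, q.2)) ?_ ?_ ?_ ?_
  · rintro ⟨n, m⟩ hq hne
    simp only [Finset.mem_filter, Finset.mem_product] at hq
    obtain ⟨⟨hn, hm⟩, hnm⟩ := hq
    simp only [Finset.mem_filter, Finset.mem_product, Finset.mem_erase, mem_latticePts,
      add_sub_cancel]
    have hn' := (mem_gridPts L).1 hn
    have hm' := (mem_gridPts L).1 hm
    refine ⟨⟨⟨sub_ne_zero.2 hnm, sub_mem_of_mem_grid hn'.1 hm'.1, ?_⟩, hm⟩, hn⟩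
    have h1 := hsep n m (norm_pos_iff.1 hn'.2.1) (norm_pos_iff.1 hm'.2.1)
    have h2 : ‖(φ : ℂ) * (levelPow α k n - levelPow α k m)‖ < A := by
      by_contra hA
      exact hne (hf.zero _ (not_lt.1 hA))
    rw [norm_mul, Complex.norm_real, Real.norm_eq_abs, abs_of_pos hφ] at h2
    have h3 : N ^ (α - 1) ≤ (max ‖n‖ ‖m‖) ^ (α - 1) :=
      Real.rpow_le_rpow_of_nonpos (lt_max_of_lt_left hn'.2.1) (max_le hn'.2.2 hm'.2.2)
        (by linarith)
    have h4 : φ * (c * ‖n - m‖ * N ^ (α - 1)) ≤ A := by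
      refine le_trans ?_ h2.le
      gcongr
      exact le_trans (by gcongr) h1
    have e : N ^ (1 - α) = (N ^ (α - 1))⁻¹ := by rw [← Real.rpow_neg hN.le]; ring_nf
    rw [e, ← div_eq_mul_inv, div_div, le_div_iff₀ (by positivity)]
    linarith
  · rintro ⟨n, m⟩ _ _ ⟨n', m'⟩ _ _ h
    simp only [Prod.mk.injEq] at h ⊢
    obtain ⟨h1, h2⟩ := h
    exact ⟨by rw [h2] at h1; exact sub_left_injective h1, h2⟩
  · rintro ⟨p, m⟩ hq hne
    simp only [Finset.mem_filter, Finset.mem_product, Finset.mem_erase] at hq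
    refine ⟨(m + p, m), ?_, by simpa using hne, by simp⟩
    simp only [Finset.mem_filter, Finset.mem_product]
    exact ⟨⟨hq.2, hq.1.2⟩, by simpa using hq.1.1.1⟩
  · rintro ⟨n, m⟩ _ _
    simp

/-- The pointwise comparison between the grid sum and its continuous counterpart. -/
theorem norm_pair_sub_le {α : ℝ} (hα0 : 0 < α) (hα1 : α < 1) {c : ℝ} (hc : 0 < c) (hcα : c ≤ α)
    {k : ℤ} (hsep : ∀ (n m : ℂ), n ≠ 0 → m ≠ 0 →
      c * ‖n - m‖ * (max ‖n‖ ‖m‖) ^ (α - 1) ≤ ‖levelPow α k n - levelPow α k m‖)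
    {L : Submodule ℤ ℂ} [DiscreteTopology L] {z₀ : ℂ} {f : ℂ → ℂ} {A M : ℝ} (hf : IsTest f A M)
    {δ ρ N φ : ℝ} (hδ : 0 < δ) (hρ : 0 < ρ) (hφ : 0 < φ)
    (hφA : A ≤ φ * (c * δ ^ α * (3 * (1 + ρ / δ)) ^ (α - 1)))
    {p m w : ℂ} (hp : p ∈ L) (hpδ : δ ≤ ‖p‖) (hm : m ∈ grid L z₀) (hmw : ‖w - m‖ ≤ ρ) :
    ‖(if m ∈ gridPts L z₀ N then if m + p ∈ gridPts L z₀ N then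
          f ((φ : ℂ) * (levelPow α k (m + p) - levelPow α k m)) else 0 else 0)
        - (Metric.closedBall 0 N).indicator
          (fun w => f ((φ : ℂ) * (α * levelPow (α - 1) k w * p))) w‖
      ≤ (badSet N (‖p‖ + ρ)).indicator (fun _ => 2 * M) w +
        (Metric.closedBall 0 N).indicator
          (fun w => 4 * M * φ * ‖p‖ * (‖p‖ + ρ) * ‖w‖ ^ (α - 2)) w := by
  have hM := hf.nonneg
  set r := ‖p‖ + ρ with hr
  have hr0 : 0 < r := by positivity
  have hp0 : 0 < ‖p‖ := hδ.trans_le hpδ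
  have hsecond : 0 ≤ (Metric.closedBall (0 : ℂ) N).indicator
          (fun w => 4 * M * φ * ‖p‖ * r * ‖w‖ ^ (α - 2)) w :=
    Set.indicator_nonneg (fun _ _ => by positivity) _
  -- On the exceptional set each of the two terms is at most M.
  by_cases hbad : w ∈ badSet N r
  · rw [Set.indicator_of_mem hbad]
    refine le_trans (norm_sub_le _ _) ?_
    have h1 : ‖(if m ∈ gridPts L z₀ N then if m + p ∈ gridPts L z₀ N then
          f ((φ : ℂ) * (levelPow α k (m + p) - levelPow α k m)) else 0 else 0)‖ ≤ M := by
      split_ifs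
      · exact hf.bound _
      · simpa using hM
      · simpa using hM
    have h2 : ‖(Metric.closedBall (0 : ℂ) N).indicator
          (fun w => f ((φ : ℂ) * (α * levelPow (α - 1) k w * p))) w‖ ≤ M := by
      classical
      rw [Set.indicator_apply]
      split_ifs
      · exact hf.bound _
      · simpa using hM
    linarith
  rw [Set.indicator_of_notMem hbad, zero_add]
  have hbad1 : ‖w‖ ≤ N → r < |w.im| := fun h => by
    by_contra h'
    exact hbad (Or.inl ⟨h, not_lt.1 h'⟩)
  have hbad2 : N - r ≤ ‖w‖ → N + r < ‖w‖ := fun h => by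
    by_contra h'
    exact hbad (Or.inr ⟨h, not_lt.1 h'⟩)
  by_cases hwN : ‖w‖ ≤ N
  swap
  · have hw : w ∉ Metric.closedBall (0 : ℂ) N := by rwa [mem_closedBall_zero_iff]
    have hm' : m ∉ gridPts L z₀ N := by
      intro h
      have h1 := ((mem_gridPts L).1 h).2.2
      have h2 := hbad2 (by linarith)
      have h3 := norm_le_norm_add_norm_sub' w m
      linarith
    rw [Set.indicator_of_notMem hw, Set.indicator_of_notMem hw, if_neg hm']
    simp
  have hwN' : ‖w‖ < N - r := by
    by_contra h
    have := hbad2 (not_lt.1 h)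
    linarith
  have hw : w ∈ Metric.closedBall (0 : ℂ) N := by rwa [mem_closedBall_zero_iff]
  have him := hbad1 hwN
  have hball : ∀ x : ℂ, ‖x - w‖ ≤ r → 0 < ‖x‖ ∧ ‖x‖ ≤ N ∧ ‖x‖ ≤ ‖w‖ + r := by
    intro x hx
    refine ⟨?_, ?_, ?_⟩
    · have h1 := (Complex.abs_im_le_norm (x - w)).trans hx
      rw [norm_pos_iff]
      rintro rfl
      simp at h1
      linarith
    · have := norm_le_norm_add_norm_sub' x w
      linarith
    · have := norm_le_norm_add_norm_sub' x w
      linarith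
  have hmr : ‖m - w‖ ≤ r := by rw [norm_sub_rev]; linarith
  have hmpr : ‖m + p - w‖ ≤ r := by
    have := norm_add_le (m - w) p
    rw [norm_sub_rev m w] at this
    have e : m + p - w = m - w + p := by ring
    rw [e]; linarith
  have hmG : m ∈ gridPts L z₀ N := (mem_gridPts L).2 ⟨hm, (hball m hmr).1, (hball m hmr).2.1⟩
  have hmpG : m + p ∈ gridPts L z₀ N :=
    (mem_gridPts L).2 ⟨add_mem_grid hm hp, (hball _ hmpr).1, (hball _ hmpr).2.1⟩
  rw [if_pos hmG, if_pos hmpG, Set.indicator_of_mem hw, Set.indicator_of_mem hw]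
  -- Far from the origin the linearization applies. Near it, differences of powers are so large that
  -- both terms vanish.
  by_cases hrw : r ≤ ‖w‖ / 2
  · refine (hf.lip _ _).trans ?_
    have ht := norm_levelPow_sub_tangent_le hα0 hα1 k him hrw
      (mem_closedBall_iff_norm.2 hmpr) (mem_closedBall_iff_norm.2 hmr)
    rw [add_sub_cancel_left] at ht
    rw [← mul_sub, norm_mul, Complex.norm_real, Real.norm_eq_abs, abs_of_pos hφ]
    calc M * (φ * _) ≤ M * (φ * (4 * ‖w‖ ^ (α - 2) * r * ‖p‖)) := by gcongr
      _ = _ := by ring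
  · have hw0 : 0 < ‖w‖ := (hball w (by simpa using hr0.le)).1
    -- The moduli of w, m and m + p are at most |w| + r < 3r ≤ 3(1 + ρ/δ)|p|. Since α - 1 < 0,
    -- c|p|x^{α-1} is at least a fixed multiple of |p|^α ≥ δ^α, and `hφA` makes φ large enough.
    have hfar : ∀ x : ℝ, 0 < x → x ≤ 3 * r → A ≤ φ * (c * ‖p‖ * x ^ (α - 1)) := by
      intro x hx0 hx
      refine hφA.trans ?_
      have hκ : r ≤ (1 + ρ / δ) * ‖p‖ := by
        have : ρ ≤ ρ / δ * ‖p‖ := by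
          rw [div_mul_eq_mul_div, le_div_iff₀ hδ]; gcongr
        linarith
      have h1 : (3 * (1 + ρ / δ)) ^ (α - 1) * ‖p‖ ^ (α - 1) ≤ x ^ (α - 1) := by
        rw [← Real.mul_rpow (by positivity) (by positivity)]
        exact Real.rpow_le_rpow_of_nonpos hx0 (by linarith) (by linarith)
      have h2 : δ ^ α ≤ ‖p‖ * ‖p‖ ^ (α - 1) := by
        have : ‖p‖ * ‖p‖ ^ (α - 1) = ‖p‖ ^ α := by
          rw [Real.rpow_sub hp0, Real.rpow_one]; field_simp
        rw [this]; gcongr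
      gcongr φ * ?_
      calc c * δ ^ α * (3 * (1 + ρ / δ)) ^ (α - 1)
          ≤ c * (‖p‖ * ‖p‖ ^ (α - 1)) * (3 * (1 + ρ / δ)) ^ (α - 1) := by gcongr
        _ = c * ‖p‖ * ((3 * (1 + ρ / δ)) ^ (α - 1) * ‖p‖ ^ (α - 1)) := by ring
        _ ≤ _ := by gcongr
    have ha : f ((φ : ℂ) * (levelPow α k (m + p) - levelPow α k m)) = 0 := by
      refine hf.zero _ ?_
      have h1 := hsep (m + p) m (norm_pos_iff.1 (hball _ hmpr).1) (norm_pos_iff.1 (hball _ hmr).1)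
      rw [add_sub_cancel_left] at h1
      rw [norm_mul, Complex.norm_real, Real.norm_eq_abs, abs_of_pos hφ]
      refine (hfar (max ‖m + p‖ ‖m‖) (lt_max_of_lt_left (hball _ hmpr).1) (max_le ?_ ?_)).trans ?_
      · linarith [(hball _ hmpr).2.2]
      · linarith [(hball _ hmr).2.2]
      · gcongr
    have hb : f ((φ : ℂ) * (α * levelPow (α - 1) k w * p)) = 0 := by
      refine hf.zero _ ?_
      rw [norm_mul, Complex.norm_real, Real.norm_eq_abs, abs_of_pos hφ, norm_mul, norm_mul,
        Complex.norm_real, Real.norm_eq_abs, abs_of_pos hα0, norm_levelPow]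
      refine (hfar ‖w‖ hw0 (by linarith)).trans ?_
      calc φ * (c * ‖p‖ * ‖w‖ ^ (α - 1)) ≤ φ * (α * ‖p‖ * ‖w‖ ^ (α - 1)) := by gcongr
        _ = _ := by ring
    rw [ha, hb]
    simp
    positivity

theorem integrable_main {f : ℂ → ℂ} {A M : ℝ} (hf : IsTest f A M) (β : ℝ) (k : ℤ) (N : ℝ)
    (u v : ℂ) :
    IntegrableOn (fun w => f (u * (v * levelPow β k w))) (Metric.closedBall 0 N) := by
  refine IntegrableOn.of_bound measure_closedBall_lt_top ?_ M (ae_of_all _ fun _ => hf.bound _)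
  exact (hf.cont.measurable.comp
    (((measurable_levelPow β k).const_mul v).const_mul u)).aestronglyMeasurable

/-- A constant `c ≤ α / 2` for which the level powers of exponent `α` satisfy the separation
inequality. -/
structure IsSepConst (α c : ℝ) : Prop where
  pos : 0 < c
  le_half : c ≤ α / 2
  sep : ∀ (k : ℤ) (n m : ℂ), n ≠ 0 → m ≠ 0 →
      c * ‖n - m‖ * (max ‖n‖ ‖m‖) ^ (α - 1) ≤ ‖levelPow α k n - levelPow α k m‖

theorem IsSepConst.le {α c : ℝ} (h : IsSepConst α c) : c ≤ α := by
  linarith [h.pos, h.le_half]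

theorem exists_isSepConst {α : ℝ} (hα0 : 0 < α) (hα1 : α < 1) : ∃ c, IsSepConst α c := by
  obtain ⟨c, hc, h⟩ := exists_levelPow_separation hα0 hα1
  refine ⟨min c (α / 2), lt_min hc (by linarith), min_le_right _ _, fun k n m hn hm => le_trans ?_ (h k n m hn hm)⟩
  gcongr
  exact min_le_left _ _

/-- The radius beyond which lattice vectors do not contribute. -/
noncomputable def sepRadius (α c A N φ : ℝ) : ℝ := A * N ^ (1 - α) / (c * φ)

/-- This integrates the preceding pointwise bound: the first error is 2M times the area of the
exceptional set, the second the linearization error, with ∫ |w|^{α-2} = 2πN^α/α over the disk. -/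
theorem norm_pair_sum_sub_integral_le {α : ℝ} (hα0 : 0 < α) (hα1 : α < 1) {c : ℝ}
    (hc : IsSepConst α c) (k : ℤ)
    {L : Submodule ℤ ℂ} [DiscreteTopology L] {z₀ : ℂ} {f : ℂ → ℂ} {A M : ℝ} (hf : IsTest f A M)
    {δ ρ N φ : ℝ} (hδ : 0 < δ) (hρ : 0 < ρ) (hφ : 0 < φ)
    (hφA : A ≤ φ * (c * δ ^ α * (3 * (1 + ρ / δ)) ^ (α - 1)))
    {cell : ℂ → ℂ} (hcg : ∀ w, cell w ∈ grid L z₀) (hcw : ∀ w, ‖w - cell w‖ ≤ ρ)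
    (hcell : ∀ (G : Finset ℂ) (a : ℂ → ℂ), (∀ m ∈ G, m ∈ grid L z₀) →
      (∀ m ∈ grid L z₀, m ∉ G → a m = 0) → Integrable (fun w => a (cell w)) ∧
          ∫ w, a (cell w) = ZLattice.covolume L * ∑ m ∈ G, a m)
    {p : ℂ} (hp : p ∈ L) (hpδ : δ ≤ ‖p‖) (hpN : ‖p‖ + ρ ≤ N) :
    ‖ZLattice.covolume L * (∑ m ∈ gridPts L z₀ N,
        if m + p ∈ gridPts L z₀ N then f ((φ : ℂ) * (levelPow α k (m + p) - levelPow α k m))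
        else 0) - ∫ w in Metric.closedBall 0 N, f ((φ : ℂ) * (α * levelPow (α - 1) k w * p))‖
      ≤ 40 * M * N * (‖p‖ + ρ) +
        4 * M * φ * ‖p‖ * (‖p‖ + ρ) * (2 * Real.pi * N ^ α / α) := by
  have hM := hf.nonneg
  have hr : 0 ≤ ‖p‖ + ρ := by positivity
  have hN : 0 ≤ N := hr.trans hpN
  let a : ℂ → ℂ := fun m => if m ∈ gridPts L z₀ N then
      if m + p ∈ gridPts L z₀ N then f ((φ : ℂ) * (levelPow α k (m + p) - levelPow α k m))
        else 0 else 0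
  have hint := hcell (gridPts L z₀ N) a (fun m hm => ((mem_gridPts L).1 hm).1) (fun m _ hm => if_neg hm)
  have hbadfin : volume (badSet N (‖p‖ + ρ)) ≠ ⊤ :=
    ((volume_badSet_le hr hpN).trans_lt ENNReal.ofReal_lt_top).ne
  have hg1 : Integrable ((badSet N (‖p‖ + ρ)).indicator (fun _ => 2 * M)) :=
    (integrable_indicator_iff (measurableSet_badSet _ _)).2 (integrableOn_const hbadfin)
  have hg2 : Integrable ((Metric.closedBall (0 : ℂ) N).indicator
      (fun w => 4 * M * φ * ‖p‖ * (‖p‖ + ρ) * ‖w‖ ^ (α - 2))) :=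
    (integrable_indicator_iff measurableSet_closedBall).2
      ((integrableOn_norm_rpow (by linarith) N).const_mul _)
  have hmain : IntegrableOn (fun w => f ((φ : ℂ) * (α * levelPow (α - 1) k w * p)))
      (Metric.closedBall 0 N) := by
    have := integrable_main hf (α - 1) k N φ (α * p)
    refine this.congr (ae_of_all _ fun w => ?_)
    simp only
    ring_nf
  have h := norm_covolume_mul_sum_sub_integral_le (a := a) (cell := cell) hint
    ((integrable_indicator_iff measurableSet_closedBall).2 hmain) (hg1.add hg2)
    (fun w => norm_pair_sub_le (m := cell w) hα0 hα1 hc.pos hc.le (hc.sep k) hf hδ hρ hφ hφA hp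
      hpδ (hcg w) (hcw w))
  simp only [Pi.add_apply] at h
  rw [integral_add hg1 hg2, integral_indicator measurableSet_closedBall,
    integral_indicator measurableSet_closedBall,
    integral_indicator_const _ (measurableSet_badSet _ _), integral_const_mul,
    setIntegral_norm_rpow (by linarith) hN, smul_eq_mul, sub_add_cancel] at h
  have e : ∑ m ∈ gridPts L z₀ N, a m = ∑ m ∈ gridPts L z₀ N,
        if m + p ∈ gridPts L z₀ N then f ((φ : ℂ) * (levelPow α k (m + p) - levelPow α k m))
        else 0 := Finset.sum_congr rfl fun m hm => if_pos hm
  rw [e] at h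
  have hv : volume.real (badSet N (‖p‖ + ρ)) ≤ 20 * N * (‖p‖ + ρ) := by
    have := ENNReal.toReal_mono ENNReal.ofReal_ne_top (volume_badSet_le hr hpN)
    rwa [ENNReal.toReal_ofReal (by positivity)] at this
  have := mul_le_mul_of_nonneg_right hv (by positivity : 0 ≤ 2 * M)
  linarith

/-- With O(R²) vectors p, the exceptional set costs N R³ in total and the linearization φ R⁴ N^α.
Both have the same order in N and φ. -/
theorem rpow_error_identities {α c A N φ : ℝ} (hc : 0 < c) (hN : 0 < N) (hφ : 0 < φ) :
    N * sepRadius α c A N φ ^ 3 = A ^ 3 / c ^ 3 * (N ^ (4 - 3 * α) / φ ^ 3) ∧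
    φ * sepRadius α c A N φ ^ 4 * N ^ α = A ^ 4 / c ^ 4 * (N ^ (4 - 3 * α) / φ ^ 3) := by
  have e3 : N * (N ^ (1 - α)) ^ 3 = N ^ (4 - 3 * α) := by
    rw [← Real.rpow_natCast, ← Real.rpow_mul hN.le]
    nth_rewrite 1 [← Real.rpow_one N]
    rw [← Real.rpow_add hN]
    congr 1; push_cast; ring
  have e4 : (N ^ (1 - α)) ^ 4 * N ^ α = N ^ (4 - 3 * α) := by
    rw [← Real.rpow_natCast, ← Real.rpow_mul hN.le, ← Real.rpow_add hN]
    congr 1; push_cast; ring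
  constructor
  · rw [sepRadius, ← e3]; field_simp
  · rw [sepRadius, ← e4]; field_simp

theorem exists_pair_comparison {α : ℝ} (hα0 : 0 < α) (hα1 : α < 1) {c : ℝ} (hc : IsSepConst α c)
    (L : Submodule ℤ ℂ) [DiscreteTopology L] [IsZLattice ℝ L] (z₀ : ℂ) :
    ∃ C : ℝ, 0 < C ∧ ∀ A : ℝ, 1 < A → ∃ K : ℝ, 0 < K ∧ ∀ N φ : ℝ, 1 ≤ N → K ≤ φ →
      ∀ (k : ℤ) (f : ℂ → ℂ) (M : ℝ), IsTest f A M →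
      ‖ZLattice.covolume L * (∑ q ∈ (gridPts L z₀ N ×ˢ gridPts L z₀ N).filter (fun q => q.1 ≠ q.2),
          f ((φ : ℂ) * (levelPow α k q.1 - levelPow α k q.2)))
        - ∑ p ∈ (latticePts L (sepRadius α c A N φ)).erase 0,
          ∫ w in Metric.closedBall 0 N, f ((φ : ℂ) * (α * levelPow (α - 1) k w * p))‖
        ≤ C * M * A ^ 4 * (N ^ (4 - 3 * α) / φ ^ 3) := by
  obtain ⟨δ, hδ, hmin⟩ := exists_pos_le_norm L
  obtain ⟨ρ, hρ, hcell⟩ := exists_cell L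
  obtain ⟨cell, hc1, hc2, hc3⟩ := hcell z₀
  obtain ⟨C₀, hC₀, hcard⟩ := exists_card_latticePts_le L
  have hc0 := hc.pos
  set κ := 1 + ρ / δ with hκ
  have hκ0 : 0 < κ := by positivity
  refine ⟨C₀ * κ * (40 / c ^ 3 + 8 * Real.pi / (α * c ^ 4)), by positivity, fun A hA =>
    -- The first lower bound on φ makes the terms near the origin vanish. The second gives κR ≤ N,
    -- so that |p| + ρ ≤ N.
    ⟨max (A / (c * δ ^ α * (3 * κ) ^ (α - 1))) (κ * A / c), lt_max_of_lt_right (by positivity),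
      fun N φ hN hφ k f M hf => ?_⟩⟩
  have hA0 : 0 < A := by linarith
  have hN0 : 0 < N := by linarith
  have hφ0 : 0 < φ := lt_of_lt_of_le (by positivity) ((le_max_right _ _).trans hφ)
  have hφA : A ≤ φ * (c * δ ^ α * (3 * κ) ^ (α - 1)) := by
    rw [← div_le_iff₀ (by positivity)]
    exact (le_max_left _ _).trans hφ
  have hM := hf.nonneg
  set R := sepRadius α c A N φ with hR
  have hR0 : 0 < R := by rw [hR, sepRadius]; positivity
  have hRN : κ * R ≤ N := by
    have h1 : κ * A ≤ c * φ := by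
      have := (le_max_right _ _).trans hφ
      rw [div_le_iff₀ hc0] at this; linarith
    have h2 : N ^ (1 - α) ≤ N := by
      conv_rhs => rw [← Real.rpow_one N]
      exact Real.rpow_le_rpow_of_exponent_le hN (by linarith)
    rw [hR, sepRadius, mul_div_assoc', div_le_iff₀ (by positivity)]
    calc κ * (A * N ^ (1 - α)) = κ * A * N ^ (1 - α) := by ring
      _ ≤ c * φ * N := by gcongr
      _ = _ := by ring
  rw [sum_pairs_eq hc0 hα1 (hc.sep k) L z₀ hf hN0 hφ0, ← sepRadius, ← hR, Finset.mul_sum, ← Finset.sum_sub_distrib]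
  have hterm : ∀ p ∈ (latticePts L R).erase 0,
      ‖ZLattice.covolume L * (∑ m ∈ gridPts L z₀ N,
        if m + p ∈ gridPts L z₀ N then f ((φ : ℂ) * (levelPow α k (m + p) - levelPow α k m))
        else 0) - ∫ w in Metric.closedBall 0 N, f ((φ : ℂ) * (α * levelPow (α - 1) k w * p))‖
      ≤ κ * M * (40 * N * R + 8 * Real.pi / α * (φ * R ^ 2 * N ^ α)) := by
    intro p hp
    rw [Finset.mem_erase, mem_latticePts] at hp
    obtain ⟨hp0, hpL, hpR⟩ := hp
    have hpδ := hmin p hpL hp0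
    have hrp : ‖p‖ + ρ ≤ κ * R := by
      have : ρ ≤ ρ / δ * ‖p‖ := by
        rw [div_mul_eq_mul_div, le_div_iff₀ hδ]; gcongr
      calc ‖p‖ + ρ ≤ κ * ‖p‖ := by rw [hκ]; linarith
        _ ≤ _ := by gcongr
    refine (norm_pair_sum_sub_integral_le hα0 hα1 hc k hf hδ hρ hφ0 hφA hc1 hc2 hc3 hpL hpδ
      (hrp.trans hRN)).trans ?_
    calc 40 * M * N * (‖p‖ + ρ) + 4 * M * φ * ‖p‖ * (‖p‖ + ρ) * (2 * Real.pi * N ^ α / α)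
        ≤ 40 * M * N * (κ * R) + 4 * M * φ * R * (κ * R) * (2 * Real.pi * N ^ α / α) := by gcongr
      _ = _ := by ring
  refine (norm_sum_le_of_le _ hterm).trans ?_
  rw [Finset.sum_const, nsmul_eq_mul]
  obtain ⟨e1, e2⟩ := rpow_error_identities (α := α) (A := A) hc0 hN0 hφ0
  rw [← hR] at e1 e2
  set T := N ^ (4 - 3 * α) / φ ^ 3 with hT
  have hT0 : 0 ≤ T := by positivity
  calc _ ≤ C₀ * R ^ 2 * (κ * M * (40 * N * R + 8 * Real.pi / α * (φ * R ^ 2 * N ^ α))) := by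
        gcongr
        exact hcard R hR0
    _ = C₀ * κ * M * (40 * (N * R ^ 3) + 8 * Real.pi / α * (φ * R ^ 4 * N ^ α)) := by ring
    _ = C₀ * κ * M * (40 * (A ^ 3 / c ^ 3 * T) + 8 * Real.pi / α * (A ^ 4 / c ^ 4 * T)) := by
        rw [e1, e2]
    _ ≤ C₀ * κ * M * (40 * (A ^ 4 / c ^ 3 * T) + 8 * Real.pi / α * (A ^ 4 / c ^ 4 * T)) := by
        gcongr
        · exact hA.le
        · norm_num
    _ = _ := by field_simp

/-! ### Riemann sums over the lattice, for λ = 0. -/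

theorem IsTest.norm_integral_le {f : ℂ → ℂ} {A M : ℝ} (hf : IsTest f A M) (hA : 0 ≤ A) :
    ‖∫ z, f z‖ ≤ M * (Real.pi * A ^ 2) := by
  have h : ∫ z in Metric.closedBall 0 A, f z = ∫ z, f z := by
    refine setIntegral_eq_integral_of_forall_compl_eq_zero fun z hz => hf.zero z ?_
    rw [mem_closedBall_zero_iff, not_le] at hz
    exact hz.le
  rw [← h, ← volumeReal_closedBall 0 hA]
  exact norm_setIntegral_le_of_norm_le_const measure_closedBall_lt_top fun z _ => hf.bound z

theorem IsTest.integrable {f : ℂ → ℂ} {A M : ℝ} (hf : IsTest f A M) : Integrable f := by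
  refine hf.cont.integrable_of_hasCompactSupport
    (HasCompactSupport.intro (isCompact_closedBall 0 A) fun z hz => hf.zero z ?_)
  rw [mem_closedBall_zero_iff, not_le] at hz
  exact hz.le

/-- Multiplication by u is a rotation, which preserves area, followed by a homothety of ratio |u|.
-/
theorem integral_comp_complex_mul (f : ℂ → ℂ) (u : ℂ) (hu : u ≠ 0) :
    ∫ z, f (u * z) = ((‖u‖ ^ 2)⁻¹ : ℝ) * ∫ z, f z := by
  have hn : ‖u‖ ≠ 0 := norm_ne_zero_iff.2 hu
  have e : ∃ v : Circle, u = ‖u‖ * (v : ℂ) :=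
    ⟨⟨u / ‖u‖, mem_sphere_zero_iff_norm.2 (by simp [hn])⟩, by
      have : (‖u‖ : ℂ) ≠ 0 := by exact_mod_cast hn
      show u = ‖u‖ * (u / ‖u‖)
      field_simp⟩
  obtain ⟨v, hv⟩ := e
  have h1 : (fun z => f (u * z)) = fun z => (fun x : ℂ => f (‖u‖ • x)) (rotation v z) := by
    funext z
    simp only [rotation_apply, Complex.real_smul]
    rw [← mul_assoc, ← hv]
  rw [h1, (rotation v).measurePreserving.integral_comp (rotation v).toHomeomorph.measurableEmbedding
    (fun x : ℂ => f (‖u‖ • x)), Measure.integral_comp_smul, Complex.finrank_real_complex,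
    abs_of_nonneg (by positivity), Complex.real_smul]

/-- The Lipschitz error Mρ|u| per point, over an area of order (A/|u|)², gives A²/|u|. The term 1
accounts for the missing vector p = 0 and for the regime of large |u|. The uniformity in u allows
integration over w later. -/
theorem exists_lattice_sum_comparison (L : Submodule ℤ ℂ) [DiscreteTopology L] [IsZLattice ℝ L] :
    ∃ C : ℝ, 0 < C ∧ ∀ (A R M : ℝ) (f : ℂ → ℂ) (u : ℂ), 0 < A → u ≠ 0 → A / ‖u‖ ≤ R →
      IsTest f A M →
      ‖ZLattice.covolume L * (∑ p ∈ (latticePts L R).erase 0, f (u * p))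
        - ((‖u‖ ^ 2)⁻¹ : ℝ) * ∫ z, f z‖ ≤ C * M * (A ^ 2 / ‖u‖ + 1) := by
  obtain ⟨δ, hδ, hmin⟩ := exists_pos_le_norm L
  obtain ⟨ρ, hρ, hcell⟩ := exists_cell L
  obtain ⟨cell, hc1, hc2, hc3⟩ := hcell 0
  have hpi := Real.pi_pos
  refine ⟨Real.pi * (ρ * (1 + ρ / δ) ^ 2 + ρ ^ 2 + δ ^ 2), by positivity,
    fun A R M f u hA hu hR hf => ?_⟩
  have hM := hf.nonneg
  have hs : 0 < ‖u‖ := norm_pos_iff.2 hu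
  set s := ‖u‖ with hsdef
  have hz : ∀ p : ℂ, A / s ≤ ‖p‖ → f (u * p) = 0 := fun p hp => by
    refine hf.zero _ ?_
    rw [norm_mul]
    rw [div_le_iff₀ hs] at hp
    linarith
  -- For |u| ≤ A/δ the radius ρ is absorbed by A/|u|. For larger |u| the sum vanishes and the scaled
  -- integral is at most πMδ².
  rcases le_or_gt s (A / δ) with hsA | hsA
  · rw [← integral_comp_complex_mul f u hu]
    let a : ℂ → ℂ := fun p => if p = 0 then 0 else f (u * p)
    have hint := hc3 ((latticePts L R).erase 0) a
      (fun m hm => by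
        rw [Finset.mem_erase, mem_latticePts] at hm; rw [grid_zero]; exact hm.2.1)
      (fun m hm hmR => by
        by_cases h0 : m = 0
        · exact if_pos h0
        · rw [grid_zero] at hm
          rw [Finset.mem_erase, mem_latticePts] at hmR
          have : ¬ ‖m‖ ≤ R := fun h => hmR ⟨h0, hm, h⟩
          exact (if_neg h0).trans (hz m (by linarith)))
    have hbint : Integrable (fun z => f (u * z)) := by
      refine (hf.cont.comp (continuous_const_mul u)).integrable_of_hasCompactSupport
        (HasCompactSupport.intro (isCompact_closedBall 0 (A / s)) fun z hzs => hz z ?_)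
      rw [mem_closedBall_zero_iff, not_le] at hzs
      exact hzs.le
    have hball : ∀ r C : ℝ, Integrable ((Metric.closedBall (0 : ℂ) r).indicator (fun _ => C)) :=
      fun r C => (integrable_indicator_iff measurableSet_closedBall).2
        (integrableOn_const measure_closedBall_lt_top.ne)
    have hcmp := norm_covolume_mul_sum_sub_integral_le (a := a) (cell := cell) hint hbint
      ((hball (A / s + ρ) (M * (s * ρ))).add (hball ρ M)) (fun x => by
        have hx := norm_le_norm_add_norm_sub' x (cell x)
        have n1 : 0 ≤ (Metric.closedBall (0 : ℂ) (A / s + ρ)).indicator (fun _ => M * (s * ρ)) x :=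
          Set.indicator_nonneg (fun _ _ => by positivity) _
        have n2 : 0 ≤ (Metric.closedBall (0 : ℂ) ρ).indicator (fun _ => M) x :=
          Set.indicator_nonneg (fun _ _ => by positivity) _
        rw [Pi.add_apply]
        by_cases h0 : cell x = 0
        · have hx0 : x ∈ Metric.closedBall (0 : ℂ) ρ := by
            have := hc2 x
            rwa [h0, sub_zero, ← mem_closedBall_zero_iff] at this
          rw [Set.indicator_of_mem hx0, show a (cell x) = 0 from if_pos h0, zero_sub, norm_neg]
          linarith [hf.bound (u * x)]
        · rw [show a (cell x) = f (u * cell x) from if_neg h0]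
          by_cases hxA : x ∈ Metric.closedBall (0 : ℂ) (A / s + ρ)
          · rw [Set.indicator_of_mem hxA]
            have h1 := hf.lip (u * cell x) (u * x)
            rw [← mul_sub, norm_mul, norm_sub_rev (cell x), ← hsdef] at h1
            have h2 : M * (s * ‖x - cell x‖) ≤ M * (s * ρ) := by
              gcongr; exact hc2 x
            linarith
          · rw [mem_closedBall_zero_iff, not_le] at hxA
            have := hc2 x
            rw [hz x (by linarith), hz (cell x) (by linarith), sub_zero, norm_zero]
            linarith)
    have e : ∑ p ∈ (latticePts L R).erase 0, a p = ∑ p ∈ (latticePts L R).erase 0, f (u * p) :=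
      Finset.sum_congr rfl fun p hp => if_neg (Finset.ne_of_mem_erase hp)
    rw [e] at hcmp
    refine hcmp.trans ?_
    simp only [Pi.add_apply]
    rw [integral_add (hball _ _) (hball _ _), integral_indicator_const _ measurableSet_closedBall,
      integral_indicator_const _ measurableSet_closedBall, volumeReal_closedBall _ (by positivity),
      volumeReal_closedBall _ hρ.le, smul_eq_mul, smul_eq_mul]
    have h1 : A / s + ρ ≤ (1 + ρ / δ) * (A / s) := by
      have : δ ≤ A / s := by
        rw [le_div_iff₀ hs]; rw [le_div_iff₀ hδ] at hsA; linarith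
      have : ρ ≤ ρ / δ * (A / s) := by
        rw [div_mul_eq_mul_div, le_div_iff₀ hδ]; gcongr
      linarith
    calc Real.pi * (A / s + ρ) ^ 2 * (M * (s * ρ)) + Real.pi * ρ ^ 2 * M
        ≤ Real.pi * ((1 + ρ / δ) * (A / s)) ^ 2 * (M * (s * ρ)) + Real.pi * ρ ^ 2 * M := by gcongr
      _ = Real.pi * (ρ * (1 + ρ / δ) ^ 2) * M * (A ^ 2 / s) + Real.pi * ρ ^ 2 * M * 1 := by
          field_simp
      _ ≤ Real.pi * (ρ * (1 + ρ / δ) ^ 2 + ρ ^ 2 + δ ^ 2) * M * (A ^ 2 / s)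
          + Real.pi * (ρ * (1 + ρ / δ) ^ 2 + ρ ^ 2 + δ ^ 2) * M * 1 := by
          gcongr
          · nlinarith [sq_nonneg ρ, sq_nonneg δ]
          · have : 0 ≤ ρ * (1 + ρ / δ) ^ 2 := by positivity
            nlinarith [sq_nonneg ρ, sq_nonneg δ]
      _ = _ := by ring
  · have hAδ : A < s * δ := by rwa [div_lt_iff₀ hδ] at hsA
    have hsum : ∑ p ∈ (latticePts L R).erase 0, f (u * p) = 0 := by
      refine Finset.sum_eq_zero fun p hp => hz p ?_
      rw [Finset.mem_erase, mem_latticePts] at hp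
      have := hmin p hp.2.1 hp.1
      rw [div_le_iff₀ hs]
      nlinarith
    rw [hsum, mul_zero, zero_sub, norm_neg, norm_mul, Complex.norm_real, Real.norm_eq_abs,
      abs_of_pos (by positivity)]
    have h2 : (s ^ 2)⁻¹ * A ^ 2 ≤ δ ^ 2 := by
      rw [inv_mul_le_iff₀ (by positivity), ← mul_pow]
      gcongr
    calc (s ^ 2)⁻¹ * ‖∫ z, f z‖ ≤ (s ^ 2)⁻¹ * (M * (Real.pi * A ^ 2)) := by
          gcongr; exact hf.norm_integral_le hA.le
      _ = Real.pi * M * ((s ^ 2)⁻¹ * A ^ 2) := by ring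
      _ ≤ Real.pi * M * δ ^ 2 := by gcongr
      _ = Real.pi * δ ^ 2 * M * (0 + 1) := by ring
      _ ≤ _ := by
          gcongr
          · have : 0 ≤ ρ * (1 + ρ / δ) ^ 2 + ρ ^ 2 := by positivity
            linarith
          · positivity

/-- The finite sum over p is moved inside the integral over w and compared with the integral of f
for u = φ α w^{[α-1,k]}. Here |u|⁻² = (αφ)⁻² |w|^{2-2α}, whose integral over the disk is the stated
coefficient. The level affects only the phase of u, so no average over k is needed. -/
theorem exists_integral_comparison_of_zero {α : ℝ} (hα0 : 0 < α) (hα1 : α < 1) {c : ℝ}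
    (hc : IsSepConst α c) (L : Submodule ℤ ℂ) [DiscreteTopology L] [IsZLattice ℝ L] :
    ∃ C : ℝ, 0 < C ∧ ∀ (A N φ M : ℝ) (k : ℤ) (f : ℂ → ℂ), 0 < A → 0 < N → 0 < φ → IsTest f A M →
      ‖ZLattice.covolume L * (∑ p ∈ (latticePts L (sepRadius α c A N φ)).erase 0,
          ∫ w in Metric.closedBall 0 N, f ((φ : ℂ) * (α * levelPow (α - 1) k w * p)))
        - ((Real.pi * N ^ (4 - 2 * α) / ((2 - α) * α ^ 2 * φ ^ 2) : ℝ) : ℂ) * ∫ z, f z‖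
      ≤ C * M * (A ^ 2 * N ^ (3 - α) / φ + N ^ 2) := by
  obtain ⟨C, hC, hcmp⟩ := exists_lattice_sum_comparison L
  have hpi := Real.pi_pos
  refine ⟨C * Real.pi * (1 / α + 1), by positivity, fun A N φ M k f hA hN hφ hf => ?_⟩
  have hM := hf.nonneg
  set R := sepRadius α c A N φ with hR
  set I := ∫ z, f z with hI
  have hint : ∀ p : ℂ, IntegrableOn (fun w => f ((φ : ℂ) * (α * levelPow (α - 1) k w * p)))
      (Metric.closedBall 0 N) := by
    intro p
    have := integrable_main hf (α - 1) k N φ (α * p)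
    refine this.congr (ae_of_all _ fun w => ?_)
    simp only
    ring_nf
  have hs : ∀ w : ℂ, ‖(φ : ℂ) * (α * levelPow (α - 1) k w)‖ = φ * (α * ‖w‖ ^ (α - 1)) := by
    intro w
    rw [norm_mul, norm_mul, Complex.norm_real, Complex.norm_real, norm_levelPow, Real.norm_eq_abs,
      Real.norm_eq_abs, abs_of_pos hφ, abs_of_pos hα0]
  have hsq : ∀ w : ℂ, w ≠ 0 → (‖(φ : ℂ) * (α * levelPow (α - 1) k w)‖ ^ 2)⁻¹
      = (α ^ 2 * φ ^ 2)⁻¹ * ‖w‖ ^ (2 - 2 * α) := by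
    intro w hw
    have hw0 : 0 < ‖w‖ := norm_pos_iff.2 hw
    have : ‖w‖ ^ (2 - 2 * α) = ((‖w‖ ^ (α - 1)) ^ 2)⁻¹ := by
      rw [← Real.rpow_natCast, ← Real.rpow_mul hw0.le, ← Real.rpow_neg hw0.le]
      congr 1; push_cast; ring
    rw [hs, this, ← mul_inv]
    congr 1; ring
  have hJ : ∫ w in Metric.closedBall (0 : ℂ) N,
      ((((α ^ 2 * φ ^ 2)⁻¹ * ‖w‖ ^ (2 - 2 * α) : ℝ) : ℂ)) * I
      = ((Real.pi * N ^ (4 - 2 * α) / ((2 - α) * α ^ 2 * φ ^ 2) : ℝ) : ℂ) * I := by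
    rw [integral_mul_const, integral_complex_ofReal, integral_const_mul,
      setIntegral_norm_rpow (by linarith) hN.le]
    congr 2
    have e1 : 2 - 2 * α + 2 = 2 * (2 - α) := by ring
    have e2 : 4 - 2 * α = 2 * (2 - α) := by ring
    have h2 : (2 - α) ≠ 0 := by linarith
    rw [e1, e2]
    field_simp
  rw [← integral_finsetSum _ (fun p _ => hint p), ← integral_const_mul, ← hJ, ← integral_sub]
  -- The point w = 0 is discarded, since there u = 0 by the convention for real powers of 0.
  · have hae : ∀ᵐ w ∂(volume.restrict (Metric.closedBall (0 : ℂ) N)), w ≠ 0 ∧ ‖w‖ ≤ N := by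
      have h0 : ∀ᵐ w ∂(volume.restrict (Metric.closedBall (0 : ℂ) N)), w ≠ 0 :=
        ae_restrict_of_ae (compl_mem_ae_iff.2 (measure_singleton 0))
      filter_upwards [h0, ae_restrict_mem measurableSet_closedBall] with w h1 h2
      exact ⟨h1, mem_closedBall_zero_iff.1 h2⟩
    have : IsFiniteMeasure (volume.restrict (Metric.closedBall (0 : ℂ) N)) :=
      ⟨by rw [Measure.restrict_apply_univ]; exact measure_closedBall_lt_top⟩
    refine (norm_integral_le_of_norm_le_const
      (C := C * M * (A ^ 2 * (N ^ (1 - α) / (α * φ)) + 1)) ?_).trans ?_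
    · filter_upwards [hae] with w hw
      have hw0 : 0 < ‖w‖ := norm_pos_iff.2 hw.1
      set u := (φ : ℂ) * (α * levelPow (α - 1) k w) with hu
      have hu0 : 0 < ‖u‖ := by rw [hs]; positivity
      have hinv : 1 / ‖u‖ ≤ N ^ (1 - α) / (α * φ) := by
        have : N ^ (1 - α) = (N ^ (α - 1))⁻¹ := by
          rw [← Real.rpow_neg hN.le]; congr 1; ring
        rw [hs, this, inv_eq_one_div, div_div]
        refine one_div_le_one_div_of_le (by positivity) ?_
        have : N ^ (α - 1) ≤ ‖w‖ ^ (α - 1) :=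
          Real.rpow_le_rpow_of_nonpos hw0 hw.2 (by linarith)
        calc N ^ (α - 1) * (α * φ) ≤ ‖w‖ ^ (α - 1) * (α * φ) := by gcongr
          _ = _ := by ring
      have hRu : A / ‖u‖ ≤ R := by
        rw [div_eq_mul_one_div, hR, sepRadius, mul_div_assoc]
        have hc0 := hc.pos
        have hcα := hc.le
        gcongr A * ?_
        refine hinv.trans ?_
        gcongr
      have h := hcmp A R M f u hA (norm_pos_iff.1 hu0) hRu hf
      rw [← hsq w hw.1]
      have e : ∀ p : ℂ, (φ : ℂ) * (α * levelPow (α - 1) k w * p) = u * p := fun p => by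
        rw [hu]; ring
      simp only [e]
      refine h.trans ?_
      rw [div_eq_mul_one_div (A ^ 2)]
      gcongr
    · have hv : (volume.restrict (Metric.closedBall (0 : ℂ) N)).real Set.univ = Real.pi * N ^ 2 := by
        rw [measureReal_restrict_apply_univ, volumeReal_closedBall _ hN.le]
      rw [hv]
      have e3 : N ^ (1 - α) * N ^ 2 = N ^ (3 - α) := by
        rw [← Real.rpow_natCast, ← Real.rpow_add hN]; congr 1; push_cast; ring
      calc C * M * (A ^ 2 * (N ^ (1 - α) / (α * φ)) + 1) * (Real.pi * N ^ 2)
          = C * Real.pi * (1 / α) * M * (A ^ 2 * (N ^ (1 - α) * N ^ 2) / φ)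
            + C * Real.pi * 1 * M * N ^ 2 := by field_simp
        _ ≤ C * Real.pi * (1 / α + 1) * M * (A ^ 2 * (N ^ (1 - α) * N ^ 2) / φ)
            + C * Real.pi * (1 / α + 1) * M * N ^ 2 := by
            gcongr
            · linarith
            · have : 0 < 1 / α := by positivity
              linarith
        _ = _ := by rw [e3]; ring
  · exact (integrable_finsetSum _ fun p _ => hint p).const_mul _
  · exact (((integrableOn_norm_rpow (by linarith) N).const_mul _).ofReal).mul_const I

/-! ### Circle averages and averaging over levels, for 0 < λ < ∞. -/

/-- The integral of `f` over the circle of radius `s`, with respect to the angle. -/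
noncomputable def circInt (f : ℂ → ℂ) (s : ℝ) : ℂ :=
  ∫ θ in -Real.pi..Real.pi, f (s * Complex.exp (Complex.I * θ))

theorem continuous_circle_arg {f : ℂ → ℂ} (hf : Continuous f) (v : ℂ) :
    Continuous fun θ : ℝ => f (v * Complex.exp (Complex.I * θ)) := by fun_prop

theorem periodic_circle_arg (f : ℂ → ℂ) (v : ℂ) :
    Function.Periodic (fun θ : ℝ => f (v * Complex.exp (Complex.I * θ))) (2 * Real.pi) := by
  intro θ
  have : Complex.I * ((θ + 2 * Real.pi : ℝ) : ℂ) = Complex.I * θ + 2 * Real.pi * Complex.I := by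
    push_cast; ring
  simp only [this, Complex.exp_add, Complex.exp_two_pi_mul_I, mul_one]

theorem continuous_circInt {f : ℂ → ℂ} (hf : Continuous f) : Continuous (circInt f) := by
  refine intervalIntegral.continuous_parametric_intervalIntegral_of_continuous' ?_ _ _
  fun_prop

theorem norm_circInt_le {f : ℂ → ℂ} {M : ℝ} (hf : ∀ z, ‖f z‖ ≤ M) (s : ℝ) :
    ‖circInt f s‖ ≤ 2 * Real.pi * M := by
  have := intervalIntegral.norm_integral_le_of_norm_le_const (a := -Real.pi) (b := Real.pi)
    (f := fun θ : ℝ => f (s * Complex.exp (Complex.I * θ))) (C := M) fun θ _ => hf _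
  refine this.trans (le_of_eq ?_)
  rw [abs_of_pos (by linarith [Real.pi_pos])]; ring

theorem integral_circle_eq_circInt (f : ℂ → ℂ) (v : ℂ) (a : ℝ) :
    ∫ θ in a..a + 2 * Real.pi, f (v * Complex.exp (Complex.I * θ)) = circInt f ‖v‖ := by
  have h1 : ∀ θ : ℝ, f (v * Complex.exp (Complex.I * θ))
      = (fun θ : ℝ => f ((‖v‖ : ℂ) * Complex.exp (Complex.I * θ))) (θ + v.arg) := by
    intro θ
    have : v * Complex.exp (Complex.I * θ)
        = (‖v‖ : ℂ) * Complex.exp (Complex.I * ((θ + v.arg : ℝ) : ℂ)) := by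
      conv_lhs => rw [← Complex.norm_mul_exp_arg_mul_I v]
      rw [mul_assoc, ← Complex.exp_add]
      congr 2; push_cast; ring
    simp only [this]
  simp_rw [h1]
  rw [intervalIntegral.integral_comp_add_right
    (fun θ : ℝ => f ((‖v‖ : ℂ) * Complex.exp (Complex.I * θ)))]
  have e : a + 2 * Real.pi + v.arg = a + v.arg + 2 * Real.pi := by ring
  rw [e, (periodic_circle_arg f ‖v‖).intervalIntegral_add_eq (a + v.arg) (-Real.pi), circInt]
  congr 1; ring

/-- Whole periods contribute exactly. The leftover fraction of a period and the matching fraction of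
the mean are each at most 2πM. -/
theorem norm_integral_sub_mean_le {G : ℝ → ℂ} (hc : Continuous G)
    (hp : Function.Periodic G (2 * Real.pi)) {M : ℝ} (hM : ∀ θ, ‖G θ‖ ≤ M) (x y : ℝ) :
    ‖(∫ θ in x..y, G θ) - (((y - x) / (2 * Real.pi) : ℝ) : ℂ) * ∫ θ in x..x + 2 * Real.pi, G θ‖
      ≤ 4 * Real.pi * M := by
  have hpi := Real.two_pi_pos
  have hM0 : 0 ≤ M := (norm_nonneg _).trans (hM 0)
  set I := ∫ θ in x..x + 2 * Real.pi, G θ with hI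
  set t := (y - x) / (2 * Real.pi) with ht
  have hint : ∀ a b, IntervalIntegrable G volume a b := fun a b => hc.intervalIntegrable a b
  have hIn : ‖I‖ ≤ 2 * Real.pi * M := by
    refine (intervalIntegral.norm_integral_le_of_norm_le_const (C := M) fun θ _ => hM θ).trans ?_
    rw [add_sub_cancel_left, abs_of_pos hpi, mul_comm]
  have h1 : ∫ θ in x..y, G θ = ⌊t⌋ • I + ∫ θ in x + ⌊t⌋ • (2 * Real.pi)..y, G θ := by
    rw [hI, ← hp.intervalIntegral_add_zsmul_eq ⌊t⌋ x hint,
      intervalIntegral.integral_add_adjacent_intervals (hint _ _) (hint _ _)]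
  have hy : y = x + t * (2 * Real.pi) := by rw [ht]; field_simp; ring
  have h2 : ‖∫ θ in x + ⌊t⌋ • (2 * Real.pi)..y, G θ‖ ≤ 2 * Real.pi * M := by
    refine (intervalIntegral.norm_integral_le_of_norm_le_const (C := M) fun θ _ => hM θ).trans ?_
    have : y - (x + ⌊t⌋ • (2 * Real.pi)) = Int.fract t * (2 * Real.pi) := by
      rw [zsmul_eq_mul, Int.fract]; nth_rewrite 1 [hy]; ring
    rw [this, abs_of_nonneg (mul_nonneg (Int.fract_nonneg t) hpi.le), mul_comm]
    have := mul_le_of_le_one_left hpi.le (Int.fract_lt_one t).le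
    gcongr
  have h3 : (∫ θ in x..y, G θ) - (t : ℂ) * I
      = (∫ θ in x + ⌊t⌋ • (2 * Real.pi)..y, G θ) - ((Int.fract t : ℝ) : ℂ) * I := by
    rw [h1, Int.fract, zsmul_eq_mul]; push_cast; ring
  rw [h3]
  refine (norm_sub_le _ _).trans ?_
  have h4 : ‖((Int.fract t : ℝ) : ℂ) * I‖ ≤ 1 * (2 * Real.pi * M) := by
    rw [norm_mul, Complex.norm_real, Real.norm_eq_abs, abs_of_nonneg (Int.fract_nonneg t)]
    gcongr
    exact (Int.fract_lt_one t).le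
  linarith

/-- The angular intervals of consecutive levels form one interval, which θ = βω maps to one of
length 2π|β|(N'+N''). Only one incomplete period is lost, so the error does not depend on the number
of levels. This produces the term 1/(N'+N''). -/
theorem norm_levels_sub_le {f : ℂ → ℂ} (hf : Continuous f) {M : ℝ} (hM : ∀ z, ‖f z‖ ≤ M) {β : ℝ}
    (hβ : β ≠ 0) (v : ℂ) (N' N'' : ℕ) :
    ‖(∑ k ∈ Finset.Ico (-(N' : ℤ)) (N'' : ℤ), ∫ ω in 2 * Real.pi * (k : ℝ)..
        2 * Real.pi * (k : ℝ) + 2 * Real.pi, f (v * Complex.exp (Complex.I * ((β * ω : ℝ) : ℂ))))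
      - ((N' : ℂ) + N'') * circInt f ‖v‖‖ ≤ 4 * Real.pi * M / |β| := by
  have hcont : Continuous fun ω : ℝ => f (v * Complex.exp (Complex.I * ((β * ω : ℝ) : ℂ))) := by
    fun_prop
  set H := fun ω : ℝ => f (v * Complex.exp (Complex.I * ((β * ω : ℝ) : ℂ))) with hH
  set a := 2 * Real.pi * (-(N' : ℝ)) with ha
  have hsum : ∑ k ∈ Finset.Ico (-(N' : ℤ)) (N'' : ℤ), ∫ ω in 2 * Real.pi * (k : ℝ)..
        2 * Real.pi * (k : ℝ) + 2 * Real.pi, H ω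
      = ∫ ω in a..a + 2 * Real.pi * (N' + N'' : ℕ), H ω := by
    have h1 := intervalIntegral.sum_integral_adjacent_intervals (f := H) (μ := volume)
      (a := fun j : ℕ => a + 2 * Real.pi * (j : ℝ)) (n := N' + N'')
      (fun j _ => hcont.intervalIntegrable _ _)
    simp only [Nat.cast_zero, mul_zero, add_zero] at h1
    rw [← h1]
    have hIco : Finset.Ico (-(N' : ℤ)) (N'' : ℤ)
        = (Finset.range (N' + N'')).map
          (Nat.castEmbedding.trans (addLeftEmbedding (-(N' : ℤ)))) := by
      have : N' + N'' = ((N'' : ℤ) - -(N' : ℤ)).toNat := by omega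
      rw [this]; rfl
    rw [hIco, Finset.sum_map]
    refine Finset.sum_congr rfl fun j _ => ?_
    congr 1
    · rw [ha]; simp; ring
    · rw [ha]; simp; ring
  rw [hsum]
  have hG := norm_integral_sub_mean_le (continuous_circle_arg hf v) (periodic_circle_arg f v)
    (M := M) (fun θ => hM _) (β * a) (β * (a + 2 * Real.pi * (N' + N'' : ℕ)))
  rw [integral_circle_eq_circInt] at hG
  have hsub : ∫ ω in a..a + 2 * Real.pi * (N' + N'' : ℕ), H ω
      = (β : ℂ)⁻¹ * ∫ θ in β * a..β * (a + 2 * Real.pi * (N' + N'' : ℕ)),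
        f (v * Complex.exp (Complex.I * θ)) := by
    have := intervalIntegral.integral_comp_mul_left (a := a)
      (b := a + 2 * Real.pi * (N' + N'' : ℕ))
      (fun θ : ℝ => f (v * Complex.exp (Complex.I * θ))) hβ
    rw [hH, this, Complex.real_smul]
    push_cast
    rfl
  have hβC : (β : ℂ) ≠ 0 := by exact_mod_cast hβ
  have e : (β * (a + 2 * Real.pi * (N' + N'' : ℕ)) - β * a) / (2 * Real.pi)
      = β * ((N' : ℝ) + N'') := by
    have := Real.pi_pos
    push_cast; field_simp; ring
  rw [e] at hG
  have e2 : (β : ℂ)⁻¹ * (∫ θ in β * a..β * (a + 2 * Real.pi * (N' + N'' : ℕ)),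
        f (v * Complex.exp (Complex.I * θ))) - ((N' : ℂ) + N'') * circInt f ‖v‖
      = (β : ℂ)⁻¹ * ((∫ θ in β * a..β * (a + 2 * Real.pi * (N' + N'' : ℕ)),
        f (v * Complex.exp (Complex.I * θ)))
        - ((β * ((N' : ℝ) + N'') : ℝ) : ℂ) * circInt f ‖v‖) := by
    push_cast; field_simp
  rw [hsub, e2, norm_mul, norm_inv, Complex.norm_real, Real.norm_eq_abs, div_eq_inv_mul]
  gcongr

theorem integrableOn_polar {h : ℂ → ℂ} (hh : Integrable h) :
    IntegrableOn (fun q : ℝ × ℝ => (q.1 : ℂ) * h (q.1 * Complex.exp (Complex.I * q.2)))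
      (Set.Ioi 0 ×ˢ Set.Ioo (-Real.pi) Real.pi) := by
  have h1 : Integrable (fun q : ℝ × ℝ => h (Complex.measurableEquivRealProd.symm q)) :=
    (Complex.volume_preserving_equiv_real_prod.symm.integrable_comp_emb
      Complex.measurableEquivRealProd.symm.measurableEmbedding).2 hh
  have h2 := (integrableOn_image_iff_integrableOn_abs_det_fderiv_smul volume
    polarCoord.open_target.measurableSet
    (fun q _ => (hasFDerivAt_polarCoord_symm q).hasFDerivWithinAt) polarCoord.symm.injOn
    (fun q : ℝ × ℝ => h (Complex.measurableEquivRealProd.symm q))).1 h1.integrableOn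
  refine h2.congr_fun (fun q hq => ?_) polarCoord.open_target.measurableSet
  have hq0 : 0 < q.1 := hq.1
  simp only [det_fderivPolarCoordSymm, abs_of_pos hq0, Complex.real_smul,
    Complex.measurableEquivRealProd_symm_polarCoord_symm_apply, Complex.polarCoord_symm_apply]
  rw [mul_comm Complex.I, Complex.exp_mul_I]
  push_cast
  rfl

theorem integral_polar_eq {h : ℂ → ℂ} (hh : Integrable h) :
    IntegrableOn (fun r : ℝ => ∫ θ in -Real.pi..Real.pi,
      (r : ℂ) * h (r * Complex.exp (Complex.I * θ))) (Set.Ioi 0) ∧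
    ∫ z, h z = ∫ r in Set.Ioi (0 : ℝ), ∫ θ in -Real.pi..Real.pi,
      (r : ℂ) * h (r * Complex.exp (Complex.I * θ)) := by
  have hint := integrableOn_polar hh
  have hle : -Real.pi ≤ Real.pi := by linarith [Real.pi_pos]
  have e : ∀ r : ℝ, ∫ θ in -Real.pi..Real.pi, (r : ℂ) * h (r * Complex.exp (Complex.I * θ))
      = ∫ θ in Set.Ioo (-Real.pi) Real.pi, (r : ℂ) * h (r * Complex.exp (Complex.I * θ)) :=
    fun r => by rw [intervalIntegral.integral_of_le hle, integral_Ioc_eq_integral_Ioo]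
  simp only [e]
  refine ⟨?_, ?_⟩
  · have := hint
    rw [IntegrableOn, Measure.volume_eq_prod, ← Measure.prod_restrict] at this
    exact this.integral_prod_left
  · rw [← setIntegral_prod _ hint, ← Complex.integral_comp_polarCoord_symm]
    refine setIntegral_congr_fun polarCoord.open_target.measurableSet fun q hq => ?_
    simp only [Complex.real_smul, Complex.polarCoord_symm_apply]
    rw [mul_comm Complex.I, Complex.exp_mul_I]
    push_cast
    rfl

/-- In polar coordinates the level-k argument is the representative of θ in [2πk, 2π(k+1)[, so the
angular integral can be moved there by periodicity. -/
theorem level_integral_eq {f : ℂ → ℂ} (hf : Continuous f) {M : ℝ} (hM : ∀ z, ‖f z‖ ≤ M) (β : ℝ)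
    (k : ℤ) {N : ℝ} (hN : 0 ≤ N) (v : ℂ) :
    IntervalIntegrable (fun r : ℝ => (r : ℂ) * ∫ ω in 2 * Real.pi * (k : ℝ)..
        2 * Real.pi * (k : ℝ) + 2 * Real.pi,
        f (v * (r ^ β : ℝ) * Complex.exp (Complex.I * ((β * ω : ℝ) : ℂ)))) volume 0 N ∧
    ∫ w in Metric.closedBall 0 N, f (v * levelPow β k w)
      = ∫ r in (0 : ℝ)..N, (r : ℂ) * ∫ ω in 2 * Real.pi * (k : ℝ)..
        2 * Real.pi * (k : ℝ) + 2 * Real.pi,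
        f (v * (r ^ β : ℝ) * Complex.exp (Complex.I * ((β * ω : ℝ) : ℂ))) := by
  have hh : Integrable ((Metric.closedBall (0 : ℂ) N).indicator
      (fun w => f (v * levelPow β k w))) := by
    refine (integrable_indicator_iff measurableSet_closedBall).2 ?_
    refine IntegrableOn.of_bound measure_closedBall_lt_top ?_ M (ae_of_all _ fun _ => hM _)
    exact (hf.measurable.comp ((measurable_levelPow β k).const_mul v)).aestronglyMeasurable
  obtain ⟨h1, h2⟩ := integral_polar_eq hh
  rw [integral_indicator measurableSet_closedBall] at h2
  have hinner : ∀ r ∈ Set.Ioi (0 : ℝ), (∫ θ in -Real.pi..Real.pi,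
      (r : ℂ) * (Metric.closedBall (0 : ℂ) N).indicator (fun w => f (v * levelPow β k w))
        (r * Complex.exp (Complex.I * θ)))
      = (Set.Iic N).indicator (fun r : ℝ => (r : ℂ) * ∫ ω in 2 * Real.pi * (k : ℝ)..
        2 * Real.pi * (k : ℝ) + 2 * Real.pi,
        f (v * (r ^ β : ℝ) * Complex.exp (Complex.I * ((β * ω : ℝ) : ℂ)))) r := by
    intro r hr
    have hr0 : 0 < r := hr
    have hn : ∀ θ : ℝ, ‖(r : ℂ) * Complex.exp (Complex.I * θ)‖ = r := fun θ => by
      rw [norm_mul, norm_exp_I_mul_ofReal, mul_one, Complex.norm_real, Real.norm_eq_abs,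
        abs_of_pos hr0]
    by_cases hrN : r ≤ N
    swap
    · rw [Set.indicator_of_notMem (by simpa using hrN)]
      have : ∀ θ : ℝ, (r : ℂ) * Complex.exp (Complex.I * θ) ∉ Metric.closedBall (0 : ℂ) N :=
        fun θ => by rw [mem_closedBall_zero_iff, hn]; exact hrN
      simp [Set.indicator_of_notMem (this _)]
    rw [Set.indicator_of_mem (by simpa using hrN)]
    have hmem : ∀ θ : ℝ, (r : ℂ) * Complex.exp (Complex.I * θ) ∈ Metric.closedBall (0 : ℂ) N :=
      fun θ => by rw [mem_closedBall_zero_iff, hn]; exact hrN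
    simp_rw [Set.indicator_of_mem (hmem _)]
    rw [intervalIntegral.integral_const_mul]
    congr 1
    set G : ℝ → ℂ := fun ω => f (v * (r ^ β : ℝ) * Complex.exp (Complex.I * ((β * ω : ℝ) : ℂ)))
      with hG
    -- G itself is not 2π-periodic unless β is suitable; H is the periodic extension of its
    -- restriction to the level interval.
    set H : ℝ → ℂ := fun θ => G (toIcoMod Real.two_pi_pos (2 * Real.pi * (k : ℝ)) θ) with hH
    have hle : -Real.pi ≤ Real.pi := by linarith [Real.pi_pos]
    have e1 : ∫ θ in -Real.pi..Real.pi, f (v * levelPow β k (r * Complex.exp (Complex.I * θ)))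
        = ∫ θ in -Real.pi..Real.pi, H θ := by
      refine intervalIntegral.integral_congr_Ioo_of_le hle fun θ hθ => ?_
      have harg : ((r : ℂ) * Complex.exp (Complex.I * θ)).arg = θ := by
        rw [mul_comm Complex.I, Complex.exp_mul_I,
          Complex.arg_mul_cos_add_sin_mul_I hr0 ⟨hθ.1, hθ.2.le⟩]
      simp only [hH, hG]
      rw [levelPow_eq_lvlArg, hn, lvlArg, harg, ← mul_assoc v]
    have hper : Function.Periodic H (2 * Real.pi) := fun θ => by
      simp only [hH, toIcoMod_add_right]
    have e2 : ∫ θ in 2 * Real.pi * (k : ℝ)..2 * Real.pi * (k : ℝ) + 2 * Real.pi, H θ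
        = ∫ θ in 2 * Real.pi * (k : ℝ)..2 * Real.pi * (k : ℝ) + 2 * Real.pi, G θ := by
      refine intervalIntegral.integral_congr_Ioo_of_le (by linarith [Real.pi_pos]) fun θ hθ => ?_
      simp only [hH]
      rw [(toIcoMod_eq_self Real.two_pi_pos).2 ⟨hθ.1.le, hθ.2⟩]
    rw [e1, ← e2, ← hper.intervalIntegral_add_eq (-Real.pi)]
    congr 1; ring
  refine ⟨?_, ?_⟩
  · rw [intervalIntegrable_iff_integrableOn_Ioc_of_le hN, ← Set.Ioi_inter_Iic]
    have := h1.congr_fun hinner measurableSet_Ioi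
    rwa [IntegrableOn, integrable_indicator_iff measurableSet_Iic, IntegrableOn,
      Measure.restrict_restrict measurableSet_Iic, Set.inter_comm] at this
  · rw [h2, setIntegral_congr_fun measurableSet_Ioi hinner, setIntegral_indicator measurableSet_Iic,
      Set.Ioi_inter_Iic, intervalIntegral.integral_of_le hN]

theorem intervalIntegrable_mul_circInt {f : ℂ → ℂ} (hf : Continuous f) {M : ℝ}
    (hM : ∀ z, ‖f z‖ ≤ M) (β s : ℝ) {N : ℝ} (hN : 0 ≤ N) :
    IntervalIntegrable (fun r : ℝ => (r : ℂ) * circInt f (s * r ^ β)) volume 0 N := by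
  rw [intervalIntegrable_iff_integrableOn_Ioc_of_le hN]
  refine IntegrableOn.of_bound measure_Ioc_lt_top ?_ (N * (2 * Real.pi * M)) ?_
  · have := (continuous_circInt hf).measurable
    have h2 : Measurable fun r : ℝ => (r : ℂ) * circInt f (s * r ^ β) := by fun_prop
    exact h2.aestronglyMeasurable
  · filter_upwards [ae_restrict_mem measurableSet_Ioc] with r hr
    rw [norm_mul, Complex.norm_real, Real.norm_eq_abs, abs_of_pos hr.1]
    gcongr
    · exact hr.2
    · exact norm_circInt_le hM _

theorem norm_level_sum_sub_le {f : ℂ → ℂ} (hf : Continuous f) {M : ℝ} (hM : ∀ z, ‖f z‖ ≤ M) {β : ℝ}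
    (hβ : β ≠ 0) {N : ℝ} (hN : 0 ≤ N) (v : ℂ) (N' N'' : ℕ) :
    ‖(∑ k ∈ Finset.Ico (-(N' : ℤ)) (N'' : ℤ),
        ∫ w in Metric.closedBall 0 N, f (v * levelPow β k w))
      - ((N' : ℂ) + N'') * ∫ r in (0 : ℝ)..N, (r : ℂ) * circInt f (‖v‖ * r ^ β)‖
      ≤ 4 * Real.pi * M / |β| * N ^ 2 := by
  have hM0 : 0 ≤ M := (norm_nonneg _).trans (hM 0)
  have hl := fun k : ℤ => level_integral_eq hf hM β k hN v
  rw [Finset.sum_congr rfl fun k _ => (hl k).2,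
    ← intervalIntegral.integral_finsetSum fun k _ => (hl k).1,
    ← intervalIntegral.integral_const_mul, ← intervalIntegral.integral_sub]
  · refine (intervalIntegral.norm_integral_le_of_norm_le_const
      (C := 4 * Real.pi * M / |β| * N) fun r hr => ?_).trans (le_of_eq ?_)
    · rw [Set.uIoc_of_le hN] at hr
      rw [← Finset.mul_sum, mul_left_comm, ← mul_sub, norm_mul, Complex.norm_real,
        Real.norm_eq_abs, abs_of_pos hr.1, mul_comm]
      have h := norm_levels_sub_le hf hM hβ (v * (r ^ β : ℝ)) N' N''
      have e : ‖v * ((r ^ β : ℝ) : ℂ)‖ = ‖v‖ * r ^ β := by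
        rw [norm_mul, Complex.norm_real, Real.norm_eq_abs, abs_of_nonneg (by have := hr.1; positivity)]
      rw [e] at h
      gcongr
      · exact hr.1.le
      · exact hr.2
    · rw [sub_zero, abs_of_nonneg hN]; ring
  · have := IntervalIntegrable.sum (Finset.Ico (-(N' : ℤ)) (N'' : ℤ)) fun k _ => (hl k).1
    refine this.congr_ae (ae_of_all _ fun r => ?_)
    simp
  · exact (intervalIntegrable_mul_circInt hf hM β ‖v‖ hN).const_mul _

/-! ### Perturbing and rescaling the radial integrals. -/

/-- For s > 2A both radii are at least A, because 1 + ε ≥ 1/2, and f vanishes there. For s ≤ 2A the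
points move by s|ε| ≤ 2A|ε|, so the bound is uniform in s. -/
theorem IsTest.norm_circInt_sub_le {f : ℂ → ℂ} {A M : ℝ} (hf : IsTest f A M) (hA : 0 ≤ A)
    {s ε : ℝ} (hs : 0 ≤ s) (hε : |ε| ≤ 1 / 2) :
    ‖circInt f (s * (1 + ε)) - circInt f s‖ ≤ 4 * Real.pi * (A * M * |ε|) := by
  have hM := hf.nonneg
  have hε' := abs_le.1 hε
  have h : ∀ u : ℂ, ‖u‖ = 1 → ‖f ((s * (1 + ε) : ℝ) * u) - f (s * u)‖ ≤ 2 * (A * M * |ε|) := by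
    intro u hu
    rcases le_or_gt s (2 * A) with h1 | h1
    · refine (hf.lip _ _).trans ?_
      have e : ((s * (1 + ε) : ℝ) : ℂ) * u - s * u = ((s * ε : ℝ) : ℂ) * u := by push_cast; ring
      rw [e, norm_mul, hu, mul_one, Complex.norm_real, Real.norm_eq_abs, abs_mul, abs_of_nonneg hs]
      calc M * (s * |ε|) ≤ M * (2 * A * |ε|) := by gcongr
        _ = _ := by ring
    · rw [hf.zero, hf.zero, sub_zero, norm_zero]
      · positivity
      · rw [norm_mul, hu, mul_one, Complex.norm_real, Real.norm_eq_abs, abs_of_nonneg hs]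
        linarith
      · rw [norm_mul, hu, mul_one, Complex.norm_real, Real.norm_eq_abs,
          abs_of_nonneg (mul_nonneg hs (by linarith))]
        nlinarith
  rw [circInt, circInt, ← intervalIntegral.integral_sub]
  · refine (intervalIntegral.norm_integral_le_of_norm_le_const
      (C := 2 * (A * M * |ε|)) fun θ _ => h _ (norm_exp_I_mul_ofReal θ)).trans (le_of_eq ?_)
    rw [abs_of_pos (by linarith [Real.pi_pos] : 0 < Real.pi - -Real.pi)]; ring
  · exact (continuous_circle_arg hf.cont _).intervalIntegrable _ _
  · exact (continuous_circle_arg hf.cont _).intervalIntegrable _ _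

theorem norm_unit_integral_le {F : ℝ → ℂ} {C : ℝ} (hF : ∀ r ∈ Set.Ioc (0 : ℝ) 1, ‖F r‖ ≤ C) : ‖∫ r in (0 : ℝ)..1, (r : ℂ) * F r‖ ≤ C := by
  refine (intervalIntegral.norm_integral_le_of_norm_le_const (C := C) fun r hr => ?_).trans
    (by simp)
  rw [Set.uIoc_of_le zero_le_one] at hr
  rw [norm_mul, Complex.norm_real, Real.norm_eq_abs, abs_of_pos hr.1]
  calc r * ‖F r‖ ≤ 1 * C := by gcongr; exacts [hr.2, hF r hr]
    _ = C := one_mul _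

/-- The sum over the lattice vectors in `P` of the radial integrals of the circle averages. -/
noncomputable def radialSum (α : ℝ) (P : Finset ℂ) (f : ℂ → ℂ) (lam : ℝ) : ℂ :=
  ∑ p ∈ P, ∫ r in (0 : ℝ)..1, (r : ℂ) * circInt f (α * lam * ‖p‖ * r ^ (α - 1))

/-- The constant 10 is 6 + 4: the change of the prefactor, with |ε(2+ε)| ≤ 3|ε|, and the change of
the circle integrals. -/
theorem IsTest.norm_sq_mul_radialSum_sub_le {f : ℂ → ℂ} {A M : ℝ} (hf : IsTest f A M) (hA : 1 ≤ A)
    {α : ℝ} (hα0 : 0 < α) (P : Finset ℂ) {lam ε : ℝ} (hl : 0 < lam) (hε : |ε| ≤ 1 / 2) :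
    ‖(((lam * (1 + ε)) ^ 2 : ℝ) : ℂ) * radialSum α P f (lam * (1 + ε))
      - ((lam ^ 2 : ℝ) : ℂ) * radialSum α P f lam‖
      ≤ 10 * Real.pi * A * M * P.card * lam ^ 2 * |ε| := by
  have hM := hf.nonneg
  have hpi := Real.pi_pos
  have hA0 : 0 ≤ A := by linarith
  have h1 : ‖radialSum α P f (lam * (1 + ε))‖ ≤ P.card * (2 * Real.pi * M) := by
    refine (norm_sum_le_of_le _ fun p _ => norm_unit_integral_le (fun r _ =>
      norm_circInt_le hf.bound _)).trans ?_
    rw [Finset.sum_const, nsmul_eq_mul]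
  have h2 : ‖radialSum α P f (lam * (1 + ε)) - radialSum α P f lam‖
      ≤ P.card * (4 * Real.pi * (A * M * |ε|)) := by
    rw [radialSum, radialSum, ← Finset.sum_sub_distrib]
    refine (norm_sum_le _ _).trans ((Finset.sum_le_card_nsmul _ _ _ fun p _ => ?_).trans
      (nsmul_eq_mul _ _).le)
    rw [← intervalIntegral.integral_sub (intervalIntegrable_mul_circInt hf.cont hf.bound _ _
      zero_le_one) (intervalIntegrable_mul_circInt hf.cont hf.bound _ _ zero_le_one)]
    simp_rw [← mul_sub]
    refine norm_unit_integral_le fun r hr => ?_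
    have e : α * (lam * (1 + ε)) * ‖p‖ * r ^ (α - 1)
        = (α * lam * ‖p‖ * r ^ (α - 1)) * (1 + ε) := by ring
    rw [e]
    have := hr.1
    exact hf.norm_circInt_sub_le hA0 (by positivity) hε
  set V' := radialSum α P f (lam * (1 + ε))
  set V := radialSum α P f lam
  have e : (((lam * (1 + ε)) ^ 2 : ℝ) : ℂ) * V' - ((lam ^ 2 : ℝ) : ℂ) * V
      = ((lam ^ 2 * (ε * (2 + ε)) : ℝ) : ℂ) * V' + ((lam ^ 2 : ℝ) : ℂ) * (V' - V) := by
    push_cast; ring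
  have h3 : |ε * (2 + ε)| ≤ 3 * |ε| := by
    rw [abs_mul, mul_comm]
    gcongr
    have := abs_le.1 hε
    rw [abs_le]; constructor <;> linarith
  rw [e]
  refine (norm_add_le _ _).trans ?_
  rw [norm_mul, norm_mul, Complex.norm_real, Complex.norm_real, Real.norm_eq_abs, Real.norm_eq_abs,
    abs_mul, abs_of_pos (by positivity : 0 < lam ^ 2)]
  calc lam ^ 2 * |ε * (2 + ε)| * ‖V'‖ + lam ^ 2 * ‖V' - V‖
      ≤ lam ^ 2 * (3 * |ε|) * (P.card * (2 * Real.pi * M))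
        + lam ^ 2 * (P.card * (4 * Real.pi * (A * M * |ε|))) := by gcongr
    _ = 6 * Real.pi * 1 * M * P.card * lam ^ 2 * |ε|
        + 4 * Real.pi * A * M * P.card * lam ^ 2 * |ε| := by ring
    _ ≤ 6 * Real.pi * A * M * P.card * lam ^ 2 * |ε|
        + 4 * Real.pi * A * M * P.card * lam ^ 2 * |ε| := by gcongr
    _ = _ := by ring

/-- The substitution r ↦ Nr makes the ratio φ/N^{1-α}, which tends to λ, appear. -/
theorem radial_integral_rescale {α : ℝ} (f : ℂ → ℂ) {N : ℝ} (hN : 0 < N) (φ b : ℝ) :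
    ∫ r in (0 : ℝ)..N, (r : ℂ) * circInt f (φ * α * b * r ^ (α - 1))
      = ((N ^ 2 : ℝ) : ℂ) * ∫ r in (0 : ℝ)..1,
        (r : ℂ) * circInt f (α * (φ / N ^ (1 - α)) * b * r ^ (α - 1)) := by
  have h := intervalIntegral.integral_comp_mul_left (a := 0) (b := 1)
    (fun r : ℝ => (r : ℂ) * circInt f (φ * α * b * r ^ (α - 1))) hN.ne'
  rw [mul_zero, mul_one] at h
  have hNC : (N : ℂ) ≠ 0 := by exact_mod_cast hN.ne'
  have h2 : ∫ r in (0 : ℝ)..1, ((N * r : ℝ) : ℂ) * circInt f (φ * α * b * (N * r) ^ (α - 1))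
      = (N : ℂ) * ∫ r in (0 : ℝ)..1,
        (r : ℂ) * circInt f (α * (φ / N ^ (1 - α)) * b * r ^ (α - 1)) := by
    rw [← intervalIntegral.integral_const_mul]
    refine intervalIntegral.integral_congr_Ioo_of_le zero_le_one fun r hr => ?_
    have e : φ * α * b * (N * r) ^ (α - 1) = α * (φ / N ^ (1 - α)) * b * r ^ (α - 1) := by
      have : N ^ (1 - α) = (N ^ (α - 1))⁻¹ := by
        rw [← Real.rpow_neg hN.le]; congr 1; ring
      rw [Real.mul_rpow hN.le hr.1.le, this, div_inv_eq_mul]; ring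
    simp only [e]
    push_cast
    ring
  rw [h2, Complex.real_smul] at h
  push_cast at h
  rw [Complex.ofReal_pow, sq, mul_assoc (N : ℂ), h]
  field_simp

/-! ### Identification of the limit density. -/

theorem integral_mul_radial {f : ℂ → ℂ} {g : ℝ → ℝ} (h : Integrable fun z => f z * (g ‖z‖ : ℂ)) :
    ∫ z, f z * (g ‖z‖ : ℂ) = ∫ r in Set.Ioi (0 : ℝ), ((r * g r : ℝ) : ℂ) * circInt f r := by
  rw [(integral_polar_eq h).2]
  refine setIntegral_congr_fun measurableSet_Ioi fun r hr => ?_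
  have hn : ∀ θ : ℝ, ‖(r : ℂ) * Complex.exp (Complex.I * θ)‖ = r := fun θ => by
    rw [norm_mul, norm_exp_I_mul_ofReal, mul_one, Complex.norm_real, Real.norm_eq_abs,
      abs_of_pos hr]
  simp only [hn]
  rw [circInt, ← intervalIntegral.integral_const_mul]
  congr 1
  funext θ
  push_cast
  ring

/-- The substitution is s = κx^β; the absolute value covers decreasing powers, and β = α - 1 < 0 is
the case used. -/
theorem integral_Ioi_subst (Q : ℝ → ℂ) {κ β : ℝ} (hκ : 0 < κ) (hβ : β ≠ 0) :
    ∫ s in Set.Ioi (0 : ℝ), Q s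
      = ∫ x in Set.Ioi (0 : ℝ), ((κ * (|β| * x ^ (β - 1)) : ℝ) : ℂ) * Q (κ * x ^ β) := by
  have h1 := integral_comp_mul_left_Ioi Q 0 hκ
  rw [mul_zero] at h1
  have h2 := integral_comp_rpow_Ioi (fun y => Q (κ * y)) hβ
  rw [h1] at h2
  have hκC : (κ : ℂ) ≠ 0 := by exact_mod_cast hκ.ne'
  have h3 : ∫ s in Set.Ioi (0 : ℝ), Q s = (κ : ℂ) * ∫ x in Set.Ioi (0 : ℝ),
      (|β| * x ^ (β - 1)) • Q (κ * x ^ β) := by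
    rw [h2, Complex.real_smul]; push_cast; field_simp
  rw [h3, ← integral_const_mul]
  congr 1
  funext x
  rw [Complex.real_smul]
  push_cast
  ring

/-- The radial weight of the limit density that comes from a lattice vector of modulus `b`. -/
noncomputable def radialWeight (α lam b s : ℝ) : ℝ :=
  if b ≤ s / (α * lam) then (s / lam) ^ (-((4 - 2 * α) / (1 - α))) else 0

theorem IsTest.integrable_mul_radialWeight {f : ℂ → ℂ} {A M : ℝ} (hf : IsTest f A M) {α : ℝ}
    (hα0 : 0 < α) (hα1 : α < 1) {lam b : ℝ} (hl : 0 < lam) (hb : 0 < b) :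
    Integrable fun z => f z * (radialWeight α lam b ‖z‖ : ℂ) := by
  have hm : Measurable (radialWeight α lam b) := by
    refine Measurable.ite (measurableSet_le measurable_const (by fun_prop)) (by fun_prop)
      measurable_const
  refine hf.integrable.mul_bdd (c := (α * b) ^ (-((4 - 2 * α) / (1 - α)))) ?_ (ae_of_all _ fun z => ?_)
  · have : Measurable fun z : ℂ => (radialWeight α lam b ‖z‖ : ℂ) := by fun_prop
    exact this.aestronglyMeasurable
  · rw [Complex.norm_real, Real.norm_eq_abs, radialWeight]
    split_ifs with h
    · have h1 : α * b ≤ ‖z‖ / lam := by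
        rw [le_div_iff₀ (by positivity)] at h ⊢
        linarith
      rw [abs_of_nonneg (by positivity)]
      have : 0 ≤ (4 - 2 * α) / (1 - α) := div_nonneg (by linarith) (by linarith)
      exact Real.rpow_le_rpow_of_nonpos (by positivity) h1 (by linarith)
    · rw [abs_zero]; positivity

/-- Under s = αλb x^{α-1}, the condition b ≤ s/(αλ) becomes x ≤ 1, and the exponent of the weight is
the one for which the Jacobian leaves x dx. -/
theorem IsTest.integral_mul_radialWeight {f : ℂ → ℂ} {A M : ℝ} (hf : IsTest f A M) {α : ℝ}
    (hα0 : 0 < α) (hα1 : α < 1) {lam b : ℝ} (hl : 0 < lam) (hb : 0 < b) :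
    ∫ z, f z * (radialWeight α lam b ‖z‖ : ℂ)
      = ((lam ^ 2 * (1 - α) * (α * b) ^ (-(2 / (1 - α))) : ℝ) : ℂ) *
        ∫ r in (0 : ℝ)..1, (r : ℂ) * circInt f (α * lam * b * r ^ (α - 1)) := by
  have hβ : α - 1 < 0 := by linarith
  rw [integral_mul_radial (hf.integrable_mul_radialWeight hα0 hα1 hl hb),
    integral_Ioi_subst _ (by positivity : 0 < α * lam * b) hβ.ne, ← intervalIntegral.integral_const_mul,
    intervalIntegral.integral_of_le zero_le_one, ← Set.Ioi_inter_Iic,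
    ← setIntegral_indicator measurableSet_Iic]
  refine setIntegral_congr_fun measurableSet_Ioi fun x hx => ?_
  have hx0 : 0 < x := hx
  have hxβ : 0 < x ^ (α - 1) := by positivity
  have hdiv : α * lam * b * x ^ (α - 1) / (α * lam) = b * x ^ (α - 1) := by field_simp
  by_cases hx1 : x ≤ 1
  · rw [Set.indicator_of_mem (by simpa using hx1)]
    have h1 : 1 ≤ x ^ (α - 1) := Real.one_le_rpow_of_pos_of_le_one_of_nonpos hx0 hx1 hβ.le
    have hcond : b ≤ α * lam * b * x ^ (α - 1) / (α * lam) := by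
      rw [hdiv]; nlinarith
    simp only [radialWeight, if_pos hcond]
    have hdl : α * lam * b * x ^ (α - 1) / lam = (α * b) * x ^ (α - 1) := by field_simp
    have h1α : 1 - α ≠ 0 := by linarith
    -- The powers of x add up to (α-2) + (α-1) + (4-2α) = 1, those of αb to 2 - (4-2α)/(1-α) =
    -- -2/(1-α).
    have key : α * lam * b * (|α - 1| * x ^ (α - 1 - 1)) *
        (α * lam * b * x ^ (α - 1) * (α * lam * b * x ^ (α - 1) / lam) ^ (-((4 - 2 * α) / (1 - α))))
        = lam ^ 2 * (1 - α) * (α * b) ^ (-(2 / (1 - α))) * x := by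
      rw [hdl, Real.mul_rpow (by positivity) hxβ.le, ← Real.rpow_mul hx0.le, abs_of_neg hβ]
      have e1 : (α * b) ^ (-(2 / (1 - α)))
          = (α * b) ^ 2 * (α * b) ^ (-((4 - 2 * α) / (1 - α))) := by
        rw [← Real.rpow_natCast, ← Real.rpow_add (by positivity)]
        congr 1; push_cast; field_simp; ring
      have e2 : x ^ (α - 1 - 1) * (x ^ (α - 1) * x ^ ((α - 1) * (-((4 - 2 * α) / (1 - α))))) = x := by
        rw [← Real.rpow_add hx0, ← Real.rpow_add hx0]
        conv_rhs => rw [← Real.rpow_one x]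
        congr 1; field_simp; ring
      rw [e1]
      calc _ = lam ^ 2 * (1 - α) * ((α * b) ^ 2 * (α * b) ^ (-((4 - 2 * α) / (1 - α)))) *
          (x ^ (α - 1 - 1) * (x ^ (α - 1) * x ^ ((α - 1) * (-((4 - 2 * α) / (1 - α)))))) := by ring
        _ = _ := by rw [e2]
    have assoc : ∀ (a b : ℝ) (c : ℂ), (a : ℂ) * ((b : ℂ) * c) = ((a * b : ℝ) : ℂ) * c := by
      intro a b c; push_cast; ring
    rw [assoc, key, assoc]
  · rw [Set.indicator_of_notMem (by simpa using hx1)]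
    have h1 : x ^ (α - 1) < 1 := Real.rpow_lt_one_of_one_lt_of_neg (not_le.1 hx1) hβ
    have hcond : ¬ b ≤ α * lam * b * x ^ (α - 1) / (α * lam) := by
      rw [hdiv]; nlinarith
    simp only [radialWeight, if_neg hcond]
    simp

/-- On the support of f the moving range |p| ≤ |z|/(αλ) stays inside the fixed disk of radius R, so
the sum over p leaves the integral. The factors α^{2/(1-α)} and |p|^{2/(1-α)} of the density cancel
those of the radial integral. -/
theorem IsTest.integral_mul_rho {f : ℂ → ℂ} {A M : ℝ} (hf : IsTest f A M) {α : ℝ}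
    (hα0 : 0 < α) (hα1 : α < 1) (L : Submodule ℤ ℂ) [DiscreteTopology L] {lam : ℝ≥0∞}
    (hl0 : lam ≠ 0) (hlt : lam ≠ ⊤) {R : ℝ} (hR : A / (α * lam.toReal) ≤ R) :
    ∫ z, f z * (rho α L lam z : ℂ)
      = ((lam.toReal ^ 2 / ZLattice.covolume L : ℝ) : ℂ) *
        radialSum α ((latticePts L R).erase 0) f lam.toReal := by
  have hl : 0 < lam.toReal := ENNReal.toReal_pos hl0 hlt
  set l := lam.toReal
  have h1α : 0 < 1 - α := by linarith
  have hpt : ∀ z, f z * (rho α L lam z : ℂ) = ∑ p ∈ (latticePts L R).erase 0,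
      ((α ^ (2 / (1 - α)) / ((1 - α) * ZLattice.covolume L) * ‖p‖ ^ (2 / (1 - α)) : ℝ) : ℂ) *
        (f z * (radialWeight α l ‖p‖ ‖z‖ : ℂ)) := by
    intro z
    by_cases hz : A ≤ ‖z‖
    · simp [hf.zero z hz]
    have hzR : ‖z‖ / (α * l) ≤ R := by
      refine le_trans ?_ hR
      gcongr
      exact (not_le.1 hz).le
    have hsum : ∑ p ∈ latticePts L (‖z‖ / (α * l)), ‖p‖ ^ (2 / (1 - α))
        = ∑ p ∈ (latticePts L R).erase 0,
          if ‖p‖ ≤ ‖z‖ / (α * l) then ‖p‖ ^ (2 / (1 - α)) else 0 := by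
      rw [← Finset.sum_filter]
      symm
      refine Finset.sum_subset (fun p hp => ?_) (fun p hp hp' => ?_)
      · simp only [Finset.mem_filter, Finset.mem_erase, mem_latticePts] at hp ⊢
        exact ⟨hp.1.2.1, hp.2⟩
      · simp only [Finset.mem_filter, Finset.mem_erase, mem_latticePts] at hp hp'
        -- Omitting p = 0 is harmless, since its weight is a positive power of 0.
        have : p = 0 := by
          by_contra h0
          exact hp' ⟨⟨h0, hp.1, hp.2.trans hzR⟩, hp.2⟩
        rw [this, norm_zero, Real.zero_rpow (by positivity)]
    rw [rho, if_neg hlt, if_neg hl0, hsum, Finset.mul_sum, Complex.ofReal_sum, Finset.mul_sum]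
    refine Finset.sum_congr rfl fun p _ => ?_
    rw [radialWeight]
    split_ifs
    · push_cast; ring
    · simp
  have hint : ∀ p ∈ (latticePts L R).erase 0, Integrable fun z =>
      ((α ^ (2 / (1 - α)) / ((1 - α) * ZLattice.covolume L) * ‖p‖ ^ (2 / (1 - α)) : ℝ) : ℂ) *
        (f z * (radialWeight α l ‖p‖ ‖z‖ : ℂ)) := fun p hp =>
    (hf.integrable_mul_radialWeight hα0 hα1 hl
      (norm_pos_iff.2 (Finset.ne_of_mem_erase hp))).const_mul _
  simp_rw [hpt]
  rw [integral_finsetSum _ hint, radialSum, Finset.mul_sum]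
  refine Finset.sum_congr rfl fun p hp => ?_
  have hp0 : 0 < ‖p‖ := norm_pos_iff.2 (Finset.ne_of_mem_erase hp)
  rw [integral_const_mul, hf.integral_mul_radialWeight hα0 hα1 hl hp0, ← mul_assoc,
    ← Complex.ofReal_mul]
  congr 2
  rw [Real.rpow_neg (by positivity), Real.mul_rpow hα0.le hp0.le]
  field_simp

/-! ### Assembling the estimates. -/

/-- The sum of `f` over the scaled differences of the level-`k` powers of distinct grid points. -/
noncomputable def pairSum (α : ℝ) (L : Submodule ℤ ℂ) [DiscreteTopology L] (z₀ : ℂ) (k : ℤ)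
    (φ N : ℝ) (f : ℂ → ℂ) : ℂ :=
  ∑ q ∈ (gridPts L z₀ N ×ˢ gridPts L z₀ N).filter (fun q => q.1 ≠ q.2),
    f ((φ : ℂ) * (levelPow α k q.1 - levelPow α k q.2))

theorem integral_lvlMeasure (α : ℝ) (L : Submodule ℤ ℂ) [DiscreteTopology L] (z₀ : ℂ) (φ : ℕ → ℝ)
    (N N' N'' : ℕ) (f : ℂ → ℂ) :
    ∫ z, f z ∂(lvlMeasure α L z₀ φ N N' N'')
      = ((1 / (((N' : ℝ) + (N'' : ℝ)) * renorm α φ N) : ℝ) : ℂ) *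
        ∑ k ∈ Finset.Ico (-(N' : ℤ)) (N'' : ℤ), pairSum α L z₀ k (φ N) N f := by
  have hd : ∀ a : ℂ, Integrable f (Measure.dirac a) := fun a =>
    integrable_dirac enorm_lt_top
  have hr : 0 ≤ 1 / (((N' : ℝ) + (N'' : ℝ)) * renorm α φ N) := by
    rw [renorm]; positivity
  rw [lvlMeasure, integral_smul_measure, ENNReal.toReal_ofReal hr, Complex.real_smul,
    integral_finsetSum_measure]
  · congr 1
    refine Finset.sum_congr rfl fun k _ => ?_
    rw [integral_finsetSum_measure fun q _ => hd _, pairSum]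
    simp only [integral_dirac]
  · intro k _
    exact integrable_finsetSum_measure.2 fun q _ => hd _

/-- Distinct grid points differ by at least δ, so separation pushes every scaled difference beyond
A. This settles λ = +∞. -/
theorem exists_pairSum_eq_zero {α : ℝ} (hα0 : 0 < α) (hα1 : α < 1) (L : Submodule ℤ ℂ)
    [DiscreteTopology L] (z₀ : ℂ) :
    ∃ c : ℝ, 0 < c ∧ ∀ (N φ A M : ℝ) (k : ℤ) (f : ℂ → ℂ), 0 < N → 0 < φ →
      A ≤ c * (φ / N ^ (1 - α)) → IsTest f A M → pairSum α L z₀ k φ N f = 0 := by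
  obtain ⟨c, hc⟩ := exists_isSepConst hα0 hα1
  obtain ⟨δ, hδ, hmin⟩ := exists_pos_le_norm L
  have hc0 := hc.pos
  refine ⟨c * δ, by positivity, fun N φ A M k f hN hφ hA hf => ?_⟩
  refine Finset.sum_eq_zero fun q hq => hf.zero _ ?_
  simp only [Finset.mem_filter, Finset.mem_product, mem_gridPts] at hq
  obtain ⟨⟨hn, hm⟩, hne⟩ := hq
  have h1 := hc.sep k q.1 q.2 (norm_pos_iff.1 hn.2.1) (norm_pos_iff.1 hm.2.1)
  have h2 : N ^ (α - 1) ≤ (max ‖q.1‖ ‖q.2‖) ^ (α - 1) :=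
    Real.rpow_le_rpow_of_nonpos (lt_max_of_lt_left hn.2.1) (max_le hn.2.2 hm.2.2) (by linarith)
  have h3 := hmin _ (sub_mem_of_mem_grid hn.1 hm.1) (sub_ne_zero.2 hne)
  have e : N ^ (1 - α) = (N ^ (α - 1))⁻¹ := by
    rw [← Real.rpow_neg hN.le]; congr 1; ring
  rw [norm_mul, Complex.norm_real, Real.norm_eq_abs, abs_of_pos hφ]
  calc A ≤ c * δ * (φ / N ^ (1 - α)) := hA
    _ = φ * (c * δ * N ^ (α - 1)) := by rw [e, div_inv_eq_mul]; ring
    _ ≤ φ * (c * ‖q.1 - q.2‖ * (max ‖q.1‖ ‖q.2‖) ^ (α - 1)) := by gcongr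
    _ ≤ _ := by gcongr

theorem norm_average_sub_le {N' N'' : ℕ} (h : 0 < N' + N'') {S : ℤ → ℂ} {X : ℂ} {E : ℝ}
    (hS : ∀ k, ‖S k - X‖ ≤ E) :
    ‖((1 / ((N' : ℝ) + N'') : ℝ) : ℂ) * ∑ k ∈ Finset.Ico (-(N' : ℤ)) (N'' : ℤ), S k - X‖ ≤ E := by
  have hK : (0 : ℝ) < (N' : ℝ) + N'' := by exact_mod_cast h
  have hcard : ((Finset.Ico (-(N' : ℤ)) (N'' : ℤ)).card : ℝ) = (N' : ℝ) + N'' := by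
    rw [Int.card_Ico]
    have : ((N'' : ℤ) - -(N' : ℤ)).toNat = N' + N'' := by omega
    rw [this]; push_cast; ring
  have hcardC : ((Finset.Ico (-(N' : ℤ)) (N'' : ℤ)).card : ℂ) = (((N' : ℝ) + N'' : ℝ) : ℂ) := by
    rw [← hcard]; push_cast; rfl
  have hKC : (((N' : ℝ) + N'' : ℝ) : ℂ) ≠ 0 := by exact_mod_cast hK.ne'
  have e : ((1 / ((N' : ℝ) + N'') : ℝ) : ℂ) * ∑ k ∈ Finset.Ico (-(N' : ℤ)) (N'' : ℤ), S k - X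
      = ((1 / ((N' : ℝ) + N'') : ℝ) : ℂ) * ∑ k ∈ Finset.Ico (-(N' : ℤ)) (N'' : ℤ), (S k - X) := by
    rw [Finset.sum_sub_distrib, Finset.sum_const, nsmul_eq_mul, hcardC, mul_sub, ← mul_assoc,
      ← Complex.ofReal_mul, one_div_mul_cancel hK.ne', Complex.ofReal_one, one_mul]
  rw [e, norm_mul, Complex.norm_real, Real.norm_eq_abs, abs_of_pos (by positivity)]
  calc 1 / ((N' : ℝ) + N'') * ‖∑ k ∈ Finset.Ico (-(N' : ℤ)) (N'' : ℤ), (S k - X)‖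
      ≤ 1 / ((N' : ℝ) + N'') * (((N' : ℝ) + N'') * E) := by
        gcongr
        refine (norm_sum_le_of_le _ fun k _ => hS k).trans (le_of_eq ?_)
        rw [Finset.sum_const, nsmul_eq_mul, hcard]
    _ = E := by field_simp

/-- Every main term and error is written as ψ times an expression in φ/N^{1-α} and N^α φ, so that
dividing by ψ leaves the stated error terms. -/
theorem renorm_identities {α : ℝ} {φ : ℕ → ℝ} {N : ℕ} (hN : 0 < N) (hφ : 0 < φ N) :
    0 < renorm α φ N ∧
    (N : ℝ) ^ (4 - 2 * α) / φ N ^ 2 = renorm α φ N ∧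
    (N : ℝ) ^ (4 - 3 * α) / φ N ^ 3 = renorm α φ N * (1 / ((N : ℝ) ^ α * φ N)) ∧
    (N : ℝ) ^ (3 - α) / φ N = renorm α φ N * (φ N / (N : ℝ) ^ (1 - α)) ∧
    (N : ℝ) ^ 2 = renorm α φ N * (φ N / (N : ℝ) ^ (1 - α)) ^ 2 ∧
    (N : ℝ) ^ α * φ N = N * (φ N / (N : ℝ) ^ (1 - α)) := by
  have hN0 : (0 : ℝ) < N := by exact_mod_cast hN
  have ha : (0 : ℝ) < (N : ℝ) ^ α := by positivity
  have e1 : (N : ℝ) ^ (1 - α) = N / (N : ℝ) ^ α := by rw [Real.rpow_sub hN0, Real.rpow_one]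
  have e2 : (N : ℝ) ^ (2 - α) = (N : ℝ) ^ 2 / (N : ℝ) ^ α := by
    rw [Real.rpow_sub hN0, Real.rpow_ofNat]
  have e3 : (N : ℝ) ^ (3 - α) = (N : ℝ) ^ 3 / (N : ℝ) ^ α := by
    rw [Real.rpow_sub hN0, Real.rpow_ofNat]
  have e4 : (N : ℝ) ^ (4 - 2 * α) = (N : ℝ) ^ 4 / ((N : ℝ) ^ α) ^ 2 := by
    rw [Real.rpow_sub hN0, Real.rpow_ofNat, mul_comm, Real.rpow_mul hN0.le, Real.rpow_ofNat]
  have e5 : (N : ℝ) ^ (4 - 3 * α) = (N : ℝ) ^ 4 / ((N : ℝ) ^ α) ^ 3 := by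
    rw [Real.rpow_sub hN0, Real.rpow_ofNat, mul_comm, Real.rpow_mul hN0.le, Real.rpow_ofNat]
  refine ⟨by rw [renorm]; positivity, ?_, ?_, ?_, ?_, ?_⟩
  · rw [renorm, e4, e2]; field_simp
  · rw [renorm, e5, e2]; field_simp
  · rw [renorm, e3, e2, e1]; field_simp
  · rw [renorm, e2, e1]; field_simp
  · rw [e1]; field_simp

/-- Each level already satisfies the bound, so averaging preserves it and no term 1/(N'+N'') arises.
-/
theorem exists_bound_of_zero {α : ℝ} (hα0 : 0 < α) (hα1 : α < 1)
    (L : Submodule ℤ ℂ) [DiscreteTopology L] [IsZLattice ℝ L] (z₀ : ℂ) :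
    ∃ C : ℝ, 0 < C ∧ ∀ A : ℝ, 1 < A → ∃ K : ℝ, 0 < K ∧ ∀ (φ : ℕ → ℝ) (N N' N'' : ℕ),
      0 < N → K ≤ φ N → φ N / (N : ℝ) ^ (1 - α) ≤ 1 → 0 < N' + N'' →
      ∀ (f : ℂ → ℂ) (M : ℝ), IsTest f A M →
        ‖∫ z, f z ∂(lvlMeasure α L z₀ φ N N' N'') - ∫ z, f z * (rho α L 0 z : ℂ)‖
          ≤ C * (A ^ 4 * M * (φ N / (N : ℝ) ^ (1 - α) + 1 / ((N : ℝ) ^ α * φ N))) := by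
  obtain ⟨c, hc⟩ := exists_isSepConst hα0 hα1
  obtain ⟨C₁, hC₁, h1⟩ := exists_pair_comparison hα0 hα1 hc L z₀
  obtain ⟨C₂, hC₂, h2⟩ := exists_integral_comparison_of_zero hα0 hα1 hc L
  have hcov := ZLattice.covolume_pos L volume
  set v := ZLattice.covolume L with hv
  refine ⟨C₁ / v + 2 * C₂ / v ^ 2, by positivity, fun A hA => ?_⟩
  obtain ⟨K, hK, h3⟩ := h1 A hA
  refine ⟨K, hK, fun φ N N' N'' hN hφ hx1 hK' f M hf => ?_⟩
  have hM := hf.nonneg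
  have hφ0 : 0 < φ N := hK.trans_le hφ
  have hN0 : (0 : ℝ) < N := by exact_mod_cast hN
  have hN1 : (1 : ℝ) ≤ N := by exact_mod_cast hN
  obtain ⟨hψ, i1, i2, i3, i4, -⟩ := renorm_identities (α := α) hN hφ0
  set ψ := renorm α φ N
  set x := φ N / (N : ℝ) ^ (1 - α) with hx
  set y := 1 / ((N : ℝ) ^ α * φ N) with hy
  have hx0 : 0 < x := by positivity
  have hy0 : 0 < y := by positivity
  set I := ∫ z, f z with hI
  set X : ℂ := ((ψ * (Real.pi / (α ^ 2 * (2 - α) * v ^ 2)) : ℝ) : ℂ) * I with hX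
  have hvC : (v : ℂ) ≠ 0 := by exact_mod_cast hcov.ne'
  have hk : ∀ k : ℤ, ‖pairSum α L z₀ k (φ N) N f - X‖
      ≤ ψ * ((C₁ / v + 2 * C₂ / v ^ 2) * (A ^ 4 * M * (x + y))) := by
    intro k
    have g1 := h3 N (φ N) hN1 hφ k f M hf
    have g2 := h2 A N (φ N) M k f (by linarith) hN0 hφ0 hf
    rw [← pairSum] at g1
    set S := pairSum α L z₀ k (φ N) N f
    set B := ∑ p ∈ (latticePts L (sepRadius α c A N (φ N))).erase 0,
          ∫ w in Metric.closedBall 0 (N : ℝ), f ((φ N : ℂ) * (α * levelPow (α - 1) k w * p))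
    have e1 : ((Real.pi * (N : ℝ) ^ (4 - 2 * α) / ((2 - α) * α ^ 2 * φ N ^ 2) : ℝ) : ℂ) * I
        = (v : ℂ) ^ 2 * X := by
      have h2α : (2 - α) ≠ 0 := by linarith
      rw [hX, ← i1, ← mul_assoc]
      congr 1
      rw [← Complex.ofReal_pow, ← Complex.ofReal_mul]
      congr 1
      field_simp
    rw [e1] at g2
    have e2 : S - X = (v : ℂ)⁻¹ * (v * S - B) + ((v : ℂ) ^ 2)⁻¹ * (v * B - (v : ℂ) ^ 2 * X) := by
      field_simp; ring
    rw [e2]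
    refine (norm_add_le _ _).trans ?_
    rw [norm_mul, norm_mul, norm_inv, norm_inv, norm_pow, Complex.norm_real, Real.norm_eq_abs,
      abs_of_pos hcov]
    rw [i2] at g1
    rw [mul_div_assoc, i3, i4] at g2
    have hA4 : A ^ 2 ≤ A ^ 4 := pow_le_pow_right₀ hA.le (by norm_num)
    have hA41 : 1 ≤ A ^ 4 := one_le_pow₀ hA.le
    have b2 : A ^ 2 * (ψ * x) + ψ * x ^ 2 ≤ 2 * (ψ * (A ^ 4 * x)) := by
      have t1 : A ^ 2 * x ≤ A ^ 4 * x := by gcongr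
      -- The hypothesis φ/N^{1-α} ≤ 1 absorbs the quadratic error into the linear one.
      have t2 : x ^ 2 ≤ A ^ 4 * x := by
        rw [sq]; gcongr; linarith
      calc A ^ 2 * (ψ * x) + ψ * x ^ 2 = ψ * (A ^ 2 * x + x ^ 2) := by ring
        _ ≤ ψ * (A ^ 4 * x + A ^ 4 * x) := by gcongr
        _ = _ := by ring
    calc v⁻¹ * ‖v * S - B‖ + (v ^ 2)⁻¹ * ‖v * B - (v : ℂ) ^ 2 * X‖
        ≤ v⁻¹ * (C₁ * M * A ^ 4 * (ψ * y)) + (v ^ 2)⁻¹ * (C₂ * M * (2 * (ψ * (A ^ 4 * x)))) := by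
          gcongr
          exact g2.trans (by gcongr)
      _ = ψ * (C₁ / v * (A ^ 4 * M * (0 + y)) + 2 * C₂ / v ^ 2 * (A ^ 4 * M * (x + 0))) := by
          field_simp; ring
      _ ≤ ψ * (C₁ / v * (A ^ 4 * M * (x + y)) + 2 * C₂ / v ^ 2 * (A ^ 4 * M * (x + y))) := by
          gcongr
      _ = _ := by ring
  have havg := norm_average_sub_le hK' hk
  have hrho : ∫ z, f z * (rho α L 0 z : ℂ) = ((ψ⁻¹ : ℝ) : ℂ) * X := by
    have : ∀ z, rho α L 0 z = Real.pi / (α ^ 2 * (2 - α) * v ^ 2) := fun z => by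
      rw [rho, if_neg ENNReal.zero_ne_top, if_pos rfl]
    simp_rw [this]
    rw [integral_mul_const, hX, ← mul_assoc, ← Complex.ofReal_mul, ← mul_assoc,
      inv_mul_cancel₀ hψ.ne', one_mul, mul_comm]
  have e : ∫ z, f z ∂(lvlMeasure α L z₀ φ N N' N'') - ∫ z, f z * (rho α L 0 z : ℂ)
      = ((ψ⁻¹ : ℝ) : ℂ) * (((1 / ((N' : ℝ) + N'') : ℝ) : ℂ) *
        ∑ k ∈ Finset.Ico (-(N' : ℤ)) (N'' : ℤ), pairSum α L z₀ k (φ N) N f - X) := by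
    have hm : 1 / (((N' : ℝ) + (N'' : ℝ)) * renorm α φ N) = ψ⁻¹ * (1 / ((N' : ℝ) + N'')) := by
      change 1 / (((N' : ℝ) + (N'' : ℝ)) * ψ) = _
      rw [one_div, mul_inv, mul_comm, one_div]
    clear_value X
    rw [integral_lvlMeasure, hrho, hm, Complex.ofReal_mul]
    ring
  rw [e, norm_mul, Complex.norm_real, Real.norm_eq_abs, abs_of_pos (by positivity),
    inv_mul_le_iff₀ hψ]
  exact havg

/-- Three errors add up: passing from pairs to integrals (`b1`), averaging over levels (`b2`), and
replacing x = φ/N^{1-α} by λ (`b3`). The bound on |ε| makes x and λ comparable, and the number of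
vectors p is O(A²/x²). -/
theorem exists_bound_of_pos {α : ℝ} (hα0 : 0 < α) (hα1 : α < 1)
    (L : Submodule ℤ ℂ) [DiscreteTopology L] [IsZLattice ℝ L] (z₀ : ℂ) :
    ∃ C : ℝ, 0 < C ∧ ∀ A : ℝ, 1 < A → ∃ K : ℝ, 0 < K ∧ ∀ (φ : ℕ → ℝ) (lam : ℝ≥0∞)
      (N N' N'' : ℕ), lam ≠ 0 → lam ≠ ⊤ →
      0 < N → K ≤ φ N → |φ N / (lam.toReal * (N : ℝ) ^ (1 - α)) - 1| ≤ 1 / 2 → 0 < N' + N'' →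
      ∀ (f : ℂ → ℂ) (M : ℝ), IsTest f A M →
        ‖∫ z, f z ∂(lvlMeasure α L z₀ φ N N' N'') - ∫ z, f z * (rho α L lam z : ℂ)‖
          ≤ C * (M * (A ^ 3 * |φ N / (lam.toReal * (N : ℝ) ^ (1 - α)) - 1|
            + A ^ 4 / N * (1 / lam.toReal) + A ^ 2 / ((N' : ℝ) + N''))) := by
  obtain ⟨c, hc⟩ := exists_isSepConst hα0 hα1
  obtain ⟨C₁, hC₁, h1⟩ := exists_pair_comparison hα0 hα1 hc L z₀
  obtain ⟨C₀, hC₀, hcard⟩ := exists_card_latticePts_le L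
  have hcov := ZLattice.covolume_pos L volume
  have hc0 := hc.pos
  have hpi := Real.pi_pos
  have h1α : 0 < 1 - α := by linarith
  set v := ZLattice.covolume L with hv
  refine ⟨v⁻¹ * (2 * C₁ + 4 * Real.pi * C₀ / (c ^ 2 * (1 - α)) + 40 * Real.pi * C₀ / c ^ 2),
    by positivity, fun A hA => ?_⟩
  obtain ⟨K, hK, h3⟩ := h1 A hA
  refine ⟨K, hK, fun φ lam N N' N'' hl0 hlt hN hφ hε hK' f M hf => ?_⟩
  have hM := hf.nonneg
  have hφ0 : 0 < φ N := hK.trans_le hφ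
  have hN0 : (0 : ℝ) < N := by exact_mod_cast hN
  have hN1 : (1 : ℝ) ≤ N := by exact_mod_cast hN
  have hA0 : 0 < A := by linarith
  have hl : 0 < lam.toReal := ENNReal.toReal_pos hl0 hlt
  have hKn : (0 : ℝ) < (N' : ℝ) + N'' := by exact_mod_cast hK'
  obtain ⟨hψ, -, i2, -, i4, i5⟩ := renorm_identities (α := α) hN hφ0
  set ψ := renorm α φ N with hψdef
  set x := φ N / (N : ℝ) ^ (1 - α) with hx
  set l := lam.toReal with hldef
  set ε := φ N / (l * (N : ℝ) ^ (1 - α)) - 1 with hεdef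
  have hNα : (0 : ℝ) < (N : ℝ) ^ (1 - α) := by positivity
  have hx0 : 0 < x := by positivity
  have hxl : x = l * (1 + ε) := by rw [hεdef, hx]; field_simp; ring
  have hε' := abs_le.1 hε
  have hxlow : l / 2 ≤ x := by rw [hxl]; nlinarith
  have hxup : x ≤ 2 * l := by rw [hxl]; nlinarith
  set R := sepRadius α c A N (φ N) with hR
  have hRx : R = A / (c * x) := by rw [hR, sepRadius, hx]; field_simp
  have hR0 : 0 < R := by rw [hRx]; positivity
  set P := (latticePts L R).erase 0 with hP
  have hPcard : (P.card : ℝ) * x ^ 2 ≤ C₀ / c ^ 2 * A ^ 2 := by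
    calc (P.card : ℝ) * x ^ 2 ≤ C₀ * R ^ 2 * x ^ 2 := by gcongr; exact hcard R hR0
      _ = _ := by rw [hRx]; field_simp
  set B : ℤ → ℂ := fun k => ∑ p ∈ P,
    ∫ w in Metric.closedBall 0 (N : ℝ), f ((φ N : ℂ) * (α * levelPow (α - 1) k w * p)) with hB
  set q : ℂ := ((1 / ((N' : ℝ) + N'') : ℝ) : ℂ) with hq
  set TS := ∑ k ∈ Finset.Ico (-(N' : ℤ)) (N'' : ℤ), pairSum α L z₀ k (φ N) N f with hTS
  set TB := ∑ k ∈ Finset.Ico (-(N' : ℤ)) (N'' : ℤ), B k with hTB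
  have b1 : ‖q * ((v : ℂ) * TS - TB)‖ ≤ ψ * (2 * C₁ * (M * (A ^ 4 / N * (1 / l)))) := by
    have hk : ∀ k : ℤ, ‖((v : ℂ) * pairSum α L z₀ k (φ N) N f - B k) - 0‖
        ≤ ψ * (2 * C₁ * (M * (A ^ 4 / N * (1 / l)))) := by
      intro k
      have g1 := h3 N (φ N) hN1 hφ k f M hf
      rw [← pairSum, i2, i5] at g1
      rw [sub_zero]
      refine g1.trans ?_
      have : 1 / (N * x) ≤ 2 * (1 / N * (1 / l)) := by
        have t : 1 / x ≤ 2 * (1 / l) := by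
          rw [mul_one_div, div_le_div_iff₀ hx0 hl]; linarith
        calc 1 / (N * x) = 1 / N * (1 / x) := by field_simp
          _ ≤ 1 / N * (2 * (1 / l)) := by gcongr
          _ = _ := by ring
      calc C₁ * M * A ^ 4 * (ψ * (1 / (N * x)))
          ≤ C₁ * M * A ^ 4 * (ψ * (2 * (1 / N * (1 / l)))) := by gcongr
        _ = _ := by ring
    have := norm_average_sub_le hK' hk
    rwa [sub_zero, Finset.sum_sub_distrib, ← Finset.mul_sum] at this
  have b2 : ‖q * TB - ((ψ : ℝ) : ℂ) * (((x ^ 2 : ℝ) : ℂ) * radialSum α P f x)‖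
      ≤ ψ * (4 * Real.pi * C₀ / (c ^ 2 * (1 - α)) * (M * (A ^ 2 / ((N' : ℝ) + N'')))) := by
    have hswap : TB = ∑ p ∈ P, ∑ k ∈ Finset.Ico (-(N' : ℤ)) (N'' : ℤ),
        ∫ w in Metric.closedBall 0 (N : ℝ), f ((φ N * α * p : ℂ) * levelPow (α - 1) k w) := by
      rw [hTB, Finset.sum_comm]
      refine Finset.sum_congr rfl fun p _ => Finset.sum_congr rfl fun k _ => ?_
      congr 1; funext w; congr 1; ring
    have hrad : ((ψ : ℝ) : ℂ) * (((x ^ 2 : ℝ) : ℂ) * radialSum α P f x)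
        = ∑ p ∈ P, ∫ r in (0 : ℝ)..N, (r : ℂ) * circInt f (φ N * α * ‖p‖ * r ^ (α - 1)) := by
      rw [← mul_assoc, ← Complex.ofReal_mul, ← i4, radialSum, Finset.mul_sum]
      exact Finset.sum_congr rfl fun p _ => (radial_integral_rescale f hN0 _ _).symm
    have hterm : ∀ p ∈ P, ‖q * (∑ k ∈ Finset.Ico (-(N' : ℤ)) (N'' : ℤ),
        ∫ w in Metric.closedBall 0 (N : ℝ), f ((φ N * α * p : ℂ) * levelPow (α - 1) k w))
        - ∫ r in (0 : ℝ)..N, (r : ℂ) * circInt f (φ N * α * ‖p‖ * r ^ (α - 1))‖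
        ≤ 1 / ((N' : ℝ) + N'') * (4 * Real.pi * M / (1 - α) * N ^ 2) := by
      intro p _
      have g := norm_level_sum_sub_le hf.cont hf.bound (β := α - 1) (by linarith) hN0.le
        (φ N * α * p : ℂ) N' N''
      rw [norm_mul, norm_mul, Complex.norm_real, Complex.norm_real, Real.norm_eq_abs,
        Real.norm_eq_abs, abs_of_pos hφ0, abs_of_pos hα0, abs_of_neg (by linarith : α - 1 < 0),
        neg_sub] at g
      set J := ∫ r in (0 : ℝ)..N, (r : ℂ) * circInt f (φ N * α * ‖p‖ * r ^ (α - 1))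
      have hKC : ((N' : ℂ) + N'') ≠ 0 := by
        have : (((N' : ℝ) + N'' : ℝ) : ℂ) ≠ 0 := by exact_mod_cast hKn.ne'
        simpa using this
      have e : ∀ Y : ℂ, q * Y - J = q * (Y - ((N' : ℂ) + N'') * J) := by
        intro Y
        rw [hq]; push_cast; field_simp
      rw [e, norm_mul, hq, Complex.norm_real, Real.norm_eq_abs, abs_of_pos (by positivity)]
      gcongr
    rw [hswap, hrad, Finset.mul_sum, ← Finset.sum_sub_distrib]
    refine (norm_sum_le_of_le _ hterm).trans ?_
    rw [Finset.sum_const, nsmul_eq_mul, i4]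
    calc (P.card : ℝ) * (1 / ((N' : ℝ) + N'') * (4 * Real.pi * M / (1 - α) * (ψ * x ^ 2)))
        = ψ * (4 * Real.pi * M / (1 - α) / ((N' : ℝ) + N'')) * (P.card * x ^ 2) := by ring
      _ ≤ ψ * (4 * Real.pi * M / (1 - α) / ((N' : ℝ) + N'')) * (C₀ / c ^ 2 * A ^ 2) := by gcongr
      _ = _ := by field_simp
  have b3 : ‖((x ^ 2 : ℝ) : ℂ) * radialSum α P f x - ((l ^ 2 : ℝ) : ℂ) * radialSum α P f l‖
      ≤ 40 * Real.pi * C₀ / c ^ 2 * (M * (A ^ 3 * |ε|)) := by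
    have g := hf.norm_sq_mul_radialSum_sub_le hA.le hα0 P hl hε
    rw [← hxl] at g
    refine g.trans ?_
    have hl2 : l ^ 2 ≤ 4 * x ^ 2 := by
      calc l ^ 2 ≤ (2 * x) ^ 2 := by gcongr; linarith
        _ = _ := by ring
    calc 10 * Real.pi * A * M * P.card * l ^ 2 * |ε|
        ≤ 10 * Real.pi * A * M * P.card * (4 * x ^ 2) * |ε| := by gcongr
      _ = 40 * Real.pi * A * M * (P.card * x ^ 2) * |ε| := by ring
      _ ≤ 40 * Real.pi * A * M * (C₀ / c ^ 2 * A ^ 2) * |ε| := by gcongr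
      _ = _ := by ring
  have hrho : ∫ z, f z * (rho α L lam z : ℂ)
      = (v : ℂ)⁻¹ * (((l ^ 2 : ℝ) : ℂ) * radialSum α P f l) := by
    rw [hf.integral_mul_rho hα0 hα1 L hl0 hlt (R := R), ← mul_assoc]
    · congr 1
      push_cast
      rw [div_eq_inv_mul]
    · rw [hRx]
      -- This is why the separation constant is at most α/2: as x ≤ 2λ, the disk of radius R
      -- contains every p in the density on the support of f.
      have : c * x ≤ α * l := by
        calc c * x ≤ α / 2 * (2 * l) := by
              gcongr; exact hc.le_half
          _ = α * l := by ring
      gcongr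
  have hvC : (v : ℂ) ≠ 0 := by exact_mod_cast hcov.ne'
  have hψC : ((ψ : ℝ) : ℂ) ≠ 0 := by exact_mod_cast hψ.ne'
  have e : ∫ z, f z ∂(lvlMeasure α L z₀ φ N N' N'') - ∫ z, f z * (rho α L lam z : ℂ)
      = (v : ℂ)⁻¹ * (((ψ : ℝ) : ℂ)⁻¹ * (q * ((v : ℂ) * TS - TB))
        + ((ψ : ℝ) : ℂ)⁻¹ * (q * TB - ((ψ : ℝ) : ℂ) * (((x ^ 2 : ℝ) : ℂ) * radialSum α P f x))
        + (((x ^ 2 : ℝ) : ℂ) * radialSum α P f x - ((l ^ 2 : ℝ) : ℂ) * radialSum α P f l)) := by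
    have hm : ((1 / (((N' : ℝ) + (N'' : ℝ)) * renorm α φ N) : ℝ) : ℂ) = ((ψ : ℝ) : ℂ)⁻¹ * q := by
      change ((1 / (((N' : ℝ) + (N'' : ℝ)) * ψ) : ℝ) : ℂ) = _
      rw [hq, ← Complex.ofReal_inv, ← Complex.ofReal_mul, one_div, mul_inv, mul_comm, one_div]
    clear_value q TS TB
    rw [integral_lvlMeasure, hrho, hm, ← hTS]
    field_simp
    ring
  rw [e, norm_mul, norm_inv, Complex.norm_real, Real.norm_eq_abs, abs_of_pos hcov, mul_assoc]
  gcongr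
  have n1 : ‖((ψ : ℝ) : ℂ)⁻¹‖ = ψ⁻¹ := by
    rw [norm_inv, Complex.norm_real, Real.norm_eq_abs, abs_of_pos hψ]
  refine (norm_add₃_le).trans ?_
  rw [norm_mul, norm_mul _ (q * TB - _), n1]
  have c1 := (inv_mul_le_iff₀ hψ).2 b1
  have c2 := (inv_mul_le_iff₀ hψ).2 b2
  set t1 := M * (A ^ 4 / N * (1 / l)) with ht1
  set t2 := M * (A ^ 2 / ((N' : ℝ) + N'')) with ht2
  set t3 := M * (A ^ 3 * |ε|) with ht3
  have p1 : 0 ≤ t1 := by positivity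
  have p2 : 0 ≤ t2 := by positivity
  have p3 : 0 ≤ t3 := by positivity
  have ht : M * (A ^ 3 * |ε| + A ^ 4 / N * (1 / l) + A ^ 2 / ((N' : ℝ) + N'')) = t3 + t1 + t2 := by
    rw [ht1, ht2, ht3]; ring
  rw [ht]
  set d1 := 2 * C₁
  set d2 := 4 * Real.pi * C₀ / (c ^ 2 * (1 - α)) with hd2
  set d3 := 40 * Real.pi * C₀ / c ^ 2 with hd3
  have q1 : 0 ≤ d1 := by positivity
  have q2 : 0 ≤ d2 := by positivity
  have q3 : 0 ≤ d3 := by positivity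
  have r := add_nonneg (add_nonneg (mul_nonneg q1 (add_nonneg p2 p3))
    (mul_nonneg q2 (add_nonneg p1 p3))) (mul_nonneg q3 (add_nonneg p1 p2))
  calc _ ≤ d1 * t1 + d2 * t2 + d3 * t3 := add_le_add (add_le_add c1 c2) b3
    _ ≤ d1 * t1 + d2 * t2 + d3 * t3 + (d1 * (t2 + t3) + d2 * (t1 + t3) + d3 * (t1 + t2)) :=
        le_add_of_nonneg_right r
    _ = _ := by ring

/-! ### Comparison with the stated error terms and conclusion. -/

theorem IsScaling.tendsto_toReal {α : ℝ} {φ : ℕ → ℝ} {lam : ℝ≥0∞} (h : IsScaling α φ lam)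
    (hlam : lam ≠ ⊤) :
    Tendsto (fun N : ℕ => φ N / (N : ℝ) ^ (1 - α)) atTop (𝓝 lam.toReal) := by
  refine ((ENNReal.tendsto_toReal hlam).comp h.tendsto_ratio).congr fun N => ?_
  have := (h.pos N).le
  exact ENNReal.toReal_ofReal (by positivity)

theorem le_errTerm_zero {α : ℝ} {φ : ℕ → ℝ} {f : ℂ → ℂ} {A : ℝ} (N N' N'' : ℕ)
    (hA : 1 < A) :
    A ^ 4 * (supNorm f + supNormDeriv f) *
        (φ N / (N : ℝ) ^ (1 - α) + 1 / ((N : ℝ) ^ α * φ N)) ≤ errTerm α φ 0 f A N N' N'' := by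
  have h1 := supNorm_nonneg f
  have h2 := supNormDeriv_nonneg f
  rw [errTerm, if_pos rfl]
  refine mul_le_mul_of_nonneg_left ?_ (by positivity)
  have : 0 ≤ 1 / ((N' : ℝ) + N'') := by positivity
  linarith

/-- The power of λ + 1/λ dominates both 1 and 1/λ, and (8-6α)/(1-α) ≥ 3, so the stated error is
weaker than the one proved. -/
theorem le_errTerm_of_pos {α : ℝ} (hα0 : 0 < α) (hα1 : α < 1) {φ : ℕ → ℝ} {lam : ℝ≥0∞}
    {f : ℂ → ℂ} {A : ℝ} (N N' N'' : ℕ) (hA : 1 < A) (h0 : lam ≠ 0) (ht : lam ≠ ⊤) :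
    (supNorm f + supNormDeriv f) *
        (A ^ 3 * |φ N / (lam.toReal * (N : ℝ) ^ (1 - α)) - 1| + A ^ 4 / N * (1 / lam.toReal)
          + A ^ 2 / ((N' : ℝ) + N'')) ≤ errTerm α φ lam f A N N' N'' := by
  have h1 := supNorm_nonneg f
  have h2 := supNormDeriv_nonneg f
  have hl : 0 < lam.toReal := ENNReal.toReal_pos h0 ht
  rw [errTerm, if_neg h0, mul_assoc]
  refine mul_le_mul_of_nonneg_left ?_ (by positivity)
  set l := lam.toReal
  have hB1 : 1 ≤ l + 1 / l := by
    rcases le_total 1 l with h | h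
    · have : 0 < 1 / l := by positivity
      linarith
    · have : 1 ≤ 1 / l := by rwa [le_div_iff₀ hl, one_mul]
      linarith
  have he : 1 ≤ (10 - 8 * α) / (1 - α) := by
    rw [le_div_iff₀ (by linarith)]; linarith
  have hB : l + 1 / l ≤ (l + 1 / l) ^ ((10 - 8 * α) / (1 - α)) := by
    simpa using Real.rpow_le_rpow_of_exponent_le hB1 he
  have hA3 : A ^ 3 ≤ A ^ ((8 - 6 * α) / (1 - α)) := by
    have he3 : ((3 : ℕ) : ℝ) ≤ (8 - 6 * α) / (1 - α) := by
      rw [le_div_iff₀ (by linarith)]; push_cast; linarith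
    simpa only [Real.rpow_natCast] using Real.rpow_le_rpow_of_exponent_le hA.le he3
  set B := (l + 1 / l) ^ ((10 - 8 * α) / (1 - α))
  have hBl : 1 / l ≤ B := by linarith
  have hB1' : 1 ≤ B := hB1.trans hB
  set x := |φ N / (l * (N : ℝ) ^ (1 - α)) - 1|
  have hx : 0 ≤ x := abs_nonneg _
  have e1 : A ^ 3 * x ≤ B * (A ^ ((8 - 6 * α) / (1 - α)) * x) :=
    (mul_le_mul_of_nonneg_right hA3 hx).trans
      (le_mul_of_one_le_left (by positivity) hB1')
  have e2 : A ^ 4 / N * (1 / l) ≤ B * (A ^ 4 / N) := by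
    rw [mul_comm B]
    exact mul_le_mul_of_nonneg_left hBl (by positivity)
  have e3 : A ^ 2 / ((N' : ℝ) + N'') ≤ B * (A ^ 2 / ((N' : ℝ) + N'')) :=
    le_mul_of_one_le_left (by positivity) hB1'
  linarith

end GridCorrelation

open GridCorrelation in
theorem mainTheorem1 (α : ℝ) (hα0 : 0 < α) (hα1 : α < 1)
    (L : Submodule ℤ ℂ) [DiscreteTopology L] [IsZLattice ℝ L] (z₀ : ℂ) :
    (∀ φ : ℕ → ℝ, GridCorrelation.IsScaling α φ ⊤ → ∀ A : ℝ, 1 < A →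
      ∃ N₀ : ℕ, ∀ N : ℕ, N₀ ≤ N → ∀ N' N'' : ℕ,
        ∀ f : ℂ → ℂ, ContDiff ℝ 1 f → HasCompactSupport f → tsupport f ⊆ Metric.ball 0 A →
          ∫ z, f z ∂(GridCorrelation.lvlMeasure α L z₀ φ N N' N'') = 0) ∧
    (∃ C : ℝ, 0 < C ∧
      ∀ (φ : ℕ → ℝ) (lam : ℝ≥0∞), lam ≠ ⊤ → GridCorrelation.IsScaling α φ lam →
      ∀ A : ℝ, 1 < A →
      ∃ N₀ : ℕ, ∀ N : ℕ, N₀ ≤ N → ∀ N' N'' : ℕ, 0 < N' + N'' →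
        ∀ f : ℂ → ℂ, ContDiff ℝ 1 f → HasCompactSupport f → tsupport f ⊆ Metric.ball 0 A →
          ‖∫ z, f z ∂(GridCorrelation.lvlMeasure α L z₀ φ N N' N'')
              - ∫ z, f z * (GridCorrelation.rho α L lam z : ℂ)‖
            ≤ C * GridCorrelation.errTerm α φ lam f A N N' N'') := by
  constructor
  · intro φ hφ A _
    obtain ⟨c, hc, hzero⟩ := exists_pairSum_eq_zero hα0 hα1 L z₀
    have hev : ∀ᶠ N : ℕ in atTop,
        ENNReal.ofReal (A / c) < ENNReal.ofReal (φ N / (N : ℝ) ^ (1 - α)) :=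
      hφ.tendsto_ratio.eventually (lt_mem_nhds ENNReal.ofReal_lt_top)
    obtain ⟨N₀, hN₀⟩ := eventually_atTop.1 (hev.and (eventually_gt_atTop 0))
    refine ⟨N₀, fun N hN N' N'' f hf hc' hs => ?_⟩
    obtain ⟨h1, h2⟩ := hN₀ N hN
    have h3 := (ENNReal.ofReal_lt_ofReal_iff'.1 h1).1
    rw [integral_lvlMeasure, Finset.sum_eq_zero, mul_zero]
    intro k _
    refine hzero N (φ N) A _ k f (by exact_mod_cast h2) (hφ.pos N) ?_
      (isTest_of_contDiff hf hc' hs)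
    have := (div_lt_iff₀' hc).1 h3
    exact this.le
  · obtain ⟨C₀, hC₀, H₀⟩ := exists_bound_of_zero hα0 hα1 L z₀
    obtain ⟨C₁, hC₁, H₁⟩ := exists_bound_of_pos hα0 hα1 L z₀
    -- The constant is fixed before φ, λ and A; only N₀ depends on them, through φ(N) ≥ K and the
    -- closeness of φ/N^{1-α} to its limit.
    refine ⟨max C₀ C₁, lt_max_of_lt_left hC₀, fun φ lam hlam hφ A hA => ?_⟩
    have hlim := hφ.tendsto_toReal hlam
    have hM : ∀ f : ℂ → ℂ, 0 ≤ supNorm f + supNormDeriv f := fun f =>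
      add_nonneg (supNorm_nonneg f) (supNormDeriv_nonneg f)
    by_cases h0 : lam = 0
    · subst h0
      obtain ⟨K, -, HK⟩ := H₀ A hA
      have hev : ∀ᶠ N : ℕ in atTop, φ N / (N : ℝ) ^ (1 - α) < 1 :=
        hlim.eventually (gt_mem_nhds (by simp))
      obtain ⟨N₀, hN₀⟩ := eventually_atTop.1
        ((hev.and (eventually_gt_atTop 0)).and (hφ.tendsto_atTop.eventually_ge_atTop K))
      refine ⟨N₀, fun N hN N' N'' hpos f hf hc hs => ?_⟩
      obtain ⟨⟨h1, h2⟩, h3⟩ := hN₀ N hN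
      have hp := hφ.pos N
      refine (HK φ N N' N'' h2 h3 h1.le hpos f _ (isTest_of_contDiff hf hc hs)).trans ?_
      have := hM f
      exact mul_le_mul (le_max_left _ _) (le_errTerm_zero N N' N'' hA) (by positivity)
        (hC₀.le.trans (le_max_left _ _))
    · obtain ⟨K, -, HK⟩ := H₁ A hA
      have hl : 0 < lam.toReal := ENNReal.toReal_pos h0 hlam
      have hlim1 : Tendsto (fun N : ℕ => |φ N / (lam.toReal * (N : ℝ) ^ (1 - α)) - 1|) atTop
          (𝓝 0) := by
        have := ((hlim.div_const lam.toReal).sub_const 1).abs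
        rw [div_self hl.ne', sub_self, abs_zero] at this
        refine this.congr fun N => ?_
        rw [div_div, mul_comm lam.toReal]
      have hev := hlim1.eventually (gt_mem_nhds (show (0 : ℝ) < 1 / 2 by norm_num))
      obtain ⟨N₀, hN₀⟩ := eventually_atTop.1
        ((hev.and (eventually_gt_atTop 0)).and (hφ.tendsto_atTop.eventually_ge_atTop K))
      refine ⟨N₀, fun N hN N' N'' hpos f hf hc hs => ?_⟩
      obtain ⟨⟨h1, h2⟩, h3⟩ := hN₀ N hN
      refine (HK φ lam N N' N'' h0 hlam h2 h3 h1.le hpos f _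
        (isTest_of_contDiff hf hc hs)).trans ?_
      have := hM f
      exact mul_le_mul (le_max_right _ _) (le_errTerm_of_pos hα0 hα1 N N' N'' hA h0 hlam)
        (by positivity) (hC₀.le.trans (le_max_left _ _))
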